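/- Let $d\ge 1$ be an integer. There exist constants $C_d,N_d>0$, depending only on $d$, such that the following holds. Let $f:\mathbb{R}^d\to[0,\infty)$ be a log-concave probability density (that is, $f(ax+by)\ge f(x)^a f(y)^b$ for all $x,y\in\mathbb{R}^d$ and $a,b\ge 0$ with $a+b=1$, and $\int_{\mathbb{R}^d} f=1$) which is centered, $\int_{\mathbb{R}^d} x f(x)\,dx=0$, and isotropic, i.e. its covariance matrix is $$\mathrm{Cov}(f)=\left(\int_{\mathbb{R}^d} x_ix_jf(x)\,dx\right)_{1\le i,j\le d}=\sigma^2 I_d$$ for some $\sigma>0$. Suppose $\sigma\ge N_d$. Then $\sum_{k\in\mathbb{Z}^d} f(k)>0$, the series $\sum_{k} f(k)$, $\sum_k k_i f(k)$, $\sum_k k_ik_jf(k)$ over $k\in\mathbb{Z}^d$ converge absolutely for all $1\le i,j\le d$, and the discrete covariance matrix $\mathrm{Cov}_{\mathbb{Z}^d}(f)$ with entries $$[\mathrm{Cov}_{\mathbb{Z}^d}(f)]_{ij}=\frac{\sum_{k\in\mathbb{Z}^d}k_ik_jf(k)}{\sum_{k\in\mathbb{Z}^d}f(k)}-\frac{\sum_{k\in\mathbb{Z}^d}k_if(k)\,\sum_{k\in\mathbb{Z}^d}k_jf(k)}{\bigl(\sum_{k\in\mathbb{Z}^d}f(k)\bigr)^2}$$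 satisfies $$\bigl|[\mathrm{Cov}_{\mathbb{Z}^d}(f)]_{ii}-\sigma^2\bigr|\le C_d\,\sigma\quad(1\le i\le d),\qquad \bigl|[\mathrm{Cov}_{\mathbb{Z}^d}(f)]_{ij}\bigr|\le C_d\,\sigma\quad(i\ne j),$$ and $$\Bigl|\det\bigl(\mathrm{Cov}_{\mathbb{Z}^d}(f)\bigr)-\sigma^{2d}\Bigr|\le C_d\,\sigma^{2d-1}.$$ That is, $\det(\mathrm{Cov}_{\mathbb{Z}^d}(f))=\sigma^{2d}+O_d(\sigma^{2d-1})$ as $\sigma\to\infty$, uniformly in $f$. -/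

import Mathlib

open MeasureTheory

noncomputable section

/-- `f = exp (-V)` with `V` convex and values of `V` in `ℝ ∪ {+∞}`: `f` is nonnegative and
`f (a x + b y) ≥ f x ^ a * f y ^ b` for all convex weights `a`, `b`. (At weight `0` the convention
`0 ^ 0 = 1` makes the inequality an equality.) -/
def IsLogConcave {d : ℕ} (f : (Fin d → ℝ) → ℝ) : Prop :=
  (∀ x, 0 ≤ f x) ∧
    ∀ (x y : Fin d → ℝ) (a b : ℝ), 0 ≤ a → 0 ≤ b → a + b = 1 →
      f x ^ a * f y ^ b ≤ f (a • x + b • y)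

/-- `f` is a probability density with respect to Lebesgue measure on `ℝ^d`. -/
def IsDensity {d : ℕ} (f : (Fin d → ℝ) → ℝ) : Prop :=
  (∀ x, 0 ≤ f x) ∧ Integrable f ∧ ∫ x, f x = 1

/-- The barycenter of `f` is the origin. -/
def IsCentered {d : ℕ} (f : (Fin d → ℝ) → ℝ) : Prop :=
  ∀ i, ∫ x, x i * f x = 0

/-- The (continuous) covariance matrix of `f` on `ℝ^d`. -/
def covR {d : ℕ} (f : (Fin d → ℝ) → ℝ) : Matrix (Fin d) (Fin d) ℝ :=
  Matrix.of fun i j =>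
    (∫ x, x i * x j * f x) / (∫ x, f x)
      - ((∫ x, x i * f x) * (∫ x, x j * f x)) / (∫ x, f x) ^ 2

/-- The restriction of a function on `ℝ^d` to the lattice `ℤ^d`. -/
def latticeRestrict {d : ℕ} (f : (Fin d → ℝ) → ℝ) : (Fin d → ℤ) → ℝ :=
  fun k => f fun i => (k i : ℝ)

/-- All series that enter the discrete covariance matrix of `p` converge absolutely, and the
normalizing sum is positive. -/
def HasCovZ {d : ℕ} (p : (Fin d → ℤ) → ℝ) : Prop :=
  Summable p ∧ (∀ i, Summable fun k : Fin d → ℤ => (k i : ℝ) * p k) ∧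
    (∀ i j, Summable fun k : Fin d → ℤ => (k i : ℝ) * (k j : ℝ) * p k) ∧ 0 < ∑' k, p k

/-- The discrete covariance matrix of `p` on `ℤ^d`. -/
def covZ {d : ℕ} (p : (Fin d → ℤ) → ℝ) : Matrix (Fin d) (Fin d) ℝ :=
  Matrix.of fun i j =>
    (∑' k : Fin d → ℤ, (k i : ℝ) * (k j : ℝ) * p k) / (∑' k, p k)
      - ((∑' k : Fin d → ℤ, (k i : ℝ) * p k) * (∑' k : Fin d → ℤ, (k j : ℝ) * p k))
        / (∑' k, p k) ^ 2

end

/-! The discrete moments are Riemann sums, over unit cubes, of integrals that live on the scale `σ`.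
The total error is therefore smaller than the natural size of each moment by a factor `σ`, as soon
as two uniform facts are known: exponential decay of `f` on the scale `σ`, and control of the
variation of `f` along lines parallel to the axes.

Decay (`exists_isotropic_le_exp`). Let `K` be the set of `v` with `f (x₀ + v) ≥ f x₀ / e`; it is
convex and contains `0`. A functional that is small on `K` has small second moment about `x₀`, yet
this moment equals `σ² |u|² + u(x₀)²`. So `K` is wide in every direction, and exchanging rows of a
determinant one at a time yields a large parallelepiped in `K`. Total mass `1` then bounds `f x₀ σ ^
d`, and also `f x₀ σ ^ (d - 1) |x₀ i|` when one row is `x₀` itself. Hence far away `f` is below `1 /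
e` times its value at a suitable point near the origin, and log-concavity upgrades this to
exponential decay.

Variation (`sum_abs_sub_le_of_unimodal`). On a line `f` is unimodal, so its variation is at most
twice its supremum, of order `σ ^ (-d)`. About `σ ^ (d - 1)` lattice lines matter, which gives an
error of order `1 / σ` for the total mass. The weights `x i` and `x i * x j` have sizes `σ` and `σ ^
2` and cost these factors: the errors are `O(1)` and `O(σ)` (`exists_lattice_moments_le`).

Each covariance entry is then within `O(σ)` of that of `σ ^ 2 • 1`, and the Leibniz formula gives
the determinant. -/

/-! ### Elementary properties of log-concave functions -/

/-- A logarithmically concave function that has dropped by a factor `e` after the fraction `1 / t`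
of a segment has dropped by at least `e ^ t` at its end. -/
theorem IsLogConcave.le_mul_exp_neg {d : ℕ} {f : (Fin d → ℝ) → ℝ} (hf : IsLogConcave f)
    {p x : Fin d → ℝ} {t : ℝ} (ht : 1 ≤ t) (hp : 0 < f p)
    (hz : f (p + t⁻¹ • (x - p)) ≤ f p * Real.exp (-1)) : f x ≤ f p * Real.exp (-t) := by
  by_contra! h
  have ht0 : 0 < t := by linarith
  have hb : 0 < t⁻¹ := inv_pos.2 ht0
  have hb1 : t⁻¹ ≤ 1 := inv_le_one_of_one_le₀ ht
  have h1 := hf.2 p x (1 - t⁻¹) t⁻¹ (by linarith) hb.le (by ring)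
  have e1 : (1 - t⁻¹) • p + t⁻¹ • x = p + t⁻¹ • (x - p) := by
    module
  rw [e1] at h1
  have h2 : (f p * Real.exp (-t)) ^ t⁻¹ < f x ^ t⁻¹ :=
    Real.rpow_lt_rpow (by positivity) h hb
  rw [Real.mul_rpow hp.le (Real.exp_pos _).le, ← Real.exp_mul,
    show -t * t⁻¹ = -1 by field_simp] at h2
  have h3 : f p ^ (1 - t⁻¹) * (f p ^ t⁻¹ * Real.exp (-1)) < f p ^ (1 - t⁻¹) * f x ^ t⁻¹ :=
    mul_lt_mul_of_pos_left h2 (Real.rpow_pos_of_pos hp _)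
  rw [← mul_assoc, ← Real.rpow_add hp, sub_add_cancel, Real.rpow_one] at h3
  linarith

theorem IsLogConcave.mul_le_sq {d : ℕ} {f : (Fin d → ℝ) → ℝ} (hf : IsLogConcave f)
    (x y : Fin d → ℝ) : f x * f y ≤ f ((2 : ℝ)⁻¹ • x + (2 : ℝ)⁻¹ • y) ^ 2 := by
  have h := hf.2 x y (2 : ℝ)⁻¹ (2 : ℝ)⁻¹ (by norm_num) (by norm_num) (by norm_num)
  have h0 : 0 ≤ f x ^ (2 : ℝ)⁻¹ * f y ^ (2 : ℝ)⁻¹ :=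
    mul_nonneg (Real.rpow_nonneg (hf.1 _) _) (Real.rpow_nonneg (hf.1 _) _)
  have h2 := pow_le_pow_left₀ h0 h 2
  rw [mul_pow, ← Real.rpow_natCast, ← Real.rpow_natCast, ← Real.rpow_mul (hf.1 _),
    ← Real.rpow_mul (hf.1 _)] at h2
  simpa using h2

/-- Superlevel sets of a logarithmically concave function are convex. -/
theorem IsLogConcave.convex_superlevel {d : ℕ} {f : (Fin d → ℝ) → ℝ} (hf : IsLogConcave f)
    {c : ℝ} (hc : 0 < c) : Convex ℝ {x | c ≤ f x} := by
  intro x hx y hy a b ha hb hab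
  simp only [Set.mem_ofPred_eq] at *
  refine le_trans ?_ (hf.2 x y a b ha hb hab)
  calc c = c ^ a * c ^ b := by rw [← Real.rpow_add hc, hab, Real.rpow_one]
    _ ≤ _ := mul_le_mul (Real.rpow_le_rpow hc.le hx ha) (Real.rpow_le_rpow hc.le hy hb)
      (Real.rpow_nonneg hc.le _) (Real.rpow_nonneg (hf.1 _) _)

/-- Used to factor differences of `f` as differences of squares: one root factor keeps half the
exponential decay, the other is again unimodal on lines. -/
theorem IsLogConcave.sqrt {d : ℕ} {f : (Fin d → ℝ) → ℝ} (hf : IsLogConcave f) :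
    IsLogConcave fun x => √(f x) := by
  refine ⟨fun x => Real.sqrt_nonneg _, fun x y a b ha hb hab => ?_⟩
  have h := Real.sqrt_le_sqrt (hf.2 x y a b ha hb hab)
  rw [Real.sqrt_mul (Real.rpow_nonneg (hf.1 _) _)] at h
  refine le_trans (le_of_eq ?_) h
  simp only [Real.sqrt_eq_rpow]
  rw [← Real.rpow_mul (hf.1 _), ← Real.rpow_mul (hf.1 _), ← Real.rpow_mul (hf.1 _),
    ← Real.rpow_mul (hf.1 _), mul_comm a, mul_comm b]

theorem IsLogConcave.min_le {d : ℕ} {f : (Fin d → ℝ) → ℝ} (hf : IsLogConcave f)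
    (x y : Fin d → ℝ) {a b : ℝ} (ha : 0 ≤ a) (hb : 0 ≤ b) (hab : a + b = 1) :
    min (f x) (f y) ≤ f (a • x + b • y) := by
  rcases (le_min (hf.1 x) (hf.1 y)).eq_or_lt with h | h
  · rw [← h]; exact hf.1 _
  · exact hf.convex_superlevel h (min_le_left (f x) (f y)) (min_le_right (f x) (f y)) ha hb hab

/-! ### Moments of linear functionals -/

/-- The normalized moment conditions of a centered isotropic density with variance `σ ^ 2`. -/
structure IsIsotropicDensity {d : ℕ} (f : (Fin d → ℝ) → ℝ) (σ : ℝ) : Prop where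
  nonneg : ∀ x, 0 ≤ f x
  integrable : Integrable f
  integral_eq : ∫ x, f x = 1
  integrable_one : ∀ i, Integrable fun x : Fin d → ℝ => x i * f x
  integral_one : ∀ i, ∫ x : Fin d → ℝ, x i * f x = 0
  integrable_two : ∀ i j, Integrable fun x : Fin d → ℝ => x i * x j * f x
  integral_two : ∀ i j, ∫ x : Fin d → ℝ, x i * x j * f x = if i = j then σ ^ 2 else 0

theorem isIsotropicDensity_of_covR {d : ℕ} {f : (Fin d → ℝ) → ℝ} {σ : ℝ} (hd : IsDensity f)
    (hc : IsCentered f) (hσ : 0 < σ)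
    (hcov : covR f = σ ^ 2 • (1 : Matrix (Fin d) (Fin d) ℝ)) : IsIsotropicDensity f σ := by
  obtain ⟨h0, hi, h1⟩ := hd
  have h2 : ∀ i j, ∫ x : Fin d → ℝ, x i * x j * f x = if i = j then σ ^ 2 else 0 := by
    intro i j
    have h := congrFun (congrFun hcov i) j
    simpa [covR, h1, hc i, Matrix.one_apply] using h
  have hsq : ∀ i, Integrable fun x : Fin d → ℝ => x i * x i * f x := by
    intro i
    -- The Bochner integral of a non-integrable function is `0`, whereas this one equals `σ ^ 2 >
    -- 0`.
    by_contra hn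
    have h := h2 i i
    rw [integral_undef hn, if_pos rfl] at h
    exact (pow_pos hσ 2).ne h
  have hm := hi.aestronglyMeasurable
  have hx : ∀ i, AEStronglyMeasurable (fun x : Fin d → ℝ => x i) volume := fun i =>
    (continuous_apply i).aestronglyMeasurable
  refine ⟨h0, hi, h1, fun i => ?_, hc, fun i j => ?_, h2⟩
  · refine (hi.add (hsq i)).mono' ((hx i).mul hm) (Filter.Eventually.of_forall fun x => ?_)
    simp only [Real.norm_eq_abs, abs_mul, abs_of_nonneg (h0 x), Pi.add_apply]
    rw [← one_add_mul]
    refine mul_le_mul_of_nonneg_right ?_ (h0 x)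
    rw [← abs_mul_abs_self (x i)]
    nlinarith [sq_nonneg (|x i| - 1)]
  · refine ((hsq i).add (hsq j)).mono' (((hx i).mul (hx j)).mul hm)
      (Filter.Eventually.of_forall fun x => ?_)
    simp only [Real.norm_eq_abs, abs_mul, abs_of_nonneg (h0 x), Pi.add_apply]
    rw [← add_mul]
    refine mul_le_mul_of_nonneg_right ?_ (h0 x)
    rw [← abs_mul_abs_self (x i), ← abs_mul_abs_self (x j)]
    nlinarith [sq_nonneg (|x i| - |x j|), mul_nonneg (abs_nonneg (x i)) (abs_nonneg (x j))]

theorem linearMap_pi_apply {d : ℕ} (u : (Fin d → ℝ) →ₗ[ℝ] ℝ) (x : Fin d → ℝ) :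
    u x = ∑ i, x i * u (Pi.single i 1) := by
  rw [u.pi_apply_eq_sum_univ x]
  simp only [smul_eq_mul]
  refine Finset.sum_congr rfl fun i _ => ?_
  congr 2
  ext j
  simp [Pi.single_apply, eq_comm]

section Isotropic

variable {d : ℕ} {f : (Fin d → ℝ) → ℝ} {σ : ℝ}

theorem linear_mul_eq (u : (Fin d → ℝ) →ₗ[ℝ] ℝ) (x : Fin d → ℝ) :
    u x * f x = ∑ i, x i * f x * u (Pi.single i 1) := by
  rw [linearMap_pi_apply u, Finset.sum_mul]
  exact Finset.sum_congr rfl fun i _ => by ring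

theorem IsIsotropicDensity.integrable_linear (h : IsIsotropicDensity f σ)
    (u : (Fin d → ℝ) →ₗ[ℝ] ℝ) : Integrable fun x => u x * f x := by
  simp_rw [linear_mul_eq u]
  exact integrable_finsetSum _ fun i _ => (h.integrable_one i).mul_const _

theorem IsIsotropicDensity.integral_linear (h : IsIsotropicDensity f σ)
    (u : (Fin d → ℝ) →ₗ[ℝ] ℝ) : ∫ x, u x * f x = 0 := by
  simp_rw [linear_mul_eq u]
  rw [integral_finsetSum _ fun i _ => (h.integrable_one i).mul_const _]
  simp [integral_mul_const, h.integral_one]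

theorem sq_linear_eq (u : (Fin d → ℝ) →ₗ[ℝ] ℝ) (x : Fin d → ℝ) :
    u x ^ 2 * f x = ∑ i, ∑ j, x i * x j * f x * (u (Pi.single i 1) * u (Pi.single j 1)) := by
  rw [linearMap_pi_apply u, sq, Finset.sum_mul_sum, Finset.sum_mul]
  refine Finset.sum_congr rfl fun i _ => ?_
  rw [Finset.sum_mul]
  exact Finset.sum_congr rfl fun j _ => by ring

theorem IsIsotropicDensity.integrable_sq_linear (h : IsIsotropicDensity f σ)
    (u : (Fin d → ℝ) →ₗ[ℝ] ℝ) : Integrable fun x => u x ^ 2 * f x := by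
  simp_rw [sq_linear_eq u]
  exact integrable_finsetSum _ fun i _ => integrable_finsetSum _ fun j _ =>
    (h.integrable_two i j).mul_const _

theorem IsIsotropicDensity.integral_sq_linear (h : IsIsotropicDensity f σ)
    (u : (Fin d → ℝ) →ₗ[ℝ] ℝ) :
    ∫ x, u x ^ 2 * f x = σ ^ 2 * ∑ i, u (Pi.single i 1) ^ 2 := by
  simp_rw [sq_linear_eq u]
  rw [integral_finsetSum _ fun i _ => integrable_finsetSum _ fun j _ =>
    (h.integrable_two i j).mul_const _, Finset.mul_sum]
  refine Finset.sum_congr rfl fun i _ => ?_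
  rw [integral_finsetSum _ fun j _ => (h.integrable_two i j).mul_const _]
  simp [integral_mul_const, h.integral_two, sq]

theorem sq_linear_sub_eq (u : (Fin d → ℝ) →ₗ[ℝ] ℝ) (x₀ x : Fin d → ℝ) :
    u (x - x₀) ^ 2 * f x = u x ^ 2 * f x - 2 * u x₀ * (u x * f x) + u x₀ ^ 2 * f x := by
  rw [map_sub]; ring

theorem IsIsotropicDensity.integrable_sq_linear_sub (h : IsIsotropicDensity f σ)
    (u : (Fin d → ℝ) →ₗ[ℝ] ℝ) (x₀ : Fin d → ℝ) :
    Integrable fun x => u (x - x₀) ^ 2 * f x := by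
  simp_rw [sq_linear_sub_eq]
  exact ((h.integrable_sq_linear u).sub ((h.integrable_linear u).const_mul _)).add
    (h.integrable.const_mul _)

theorem IsIsotropicDensity.integral_sq_linear_sub (h : IsIsotropicDensity f σ)
    (u : (Fin d → ℝ) →ₗ[ℝ] ℝ) (x₀ : Fin d → ℝ) :
    ∫ x, u (x - x₀) ^ 2 * f x = σ ^ 2 * ∑ i, u (Pi.single i 1) ^ 2 + u x₀ ^ 2 := by
  simp_rw [sq_linear_sub_eq]
  have hi : Integrable fun x => u x ^ 2 * f x - 2 * u x₀ * (u x * f x) :=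
    (h.integrable_sq_linear u).sub ((h.integrable_linear u).const_mul _)
  rw [integral_add hi (h.integrable.const_mul _), integral_sub (h.integrable_sq_linear u)
    ((h.integrable_linear u).const_mul _), integral_const_mul, integral_const_mul,
    h.integral_linear, h.integral_sq_linear, h.integral_eq]
  ring

/-- If a linear functional is smaller than `a` on the set where `f (x₀ + ·)` is at least
`f x₀ / e`, then its second moment about `x₀` is of order at most `a ^ 2`. -/
theorem IsIsotropicDensity.integral_sq_linear_sub_le (h : IsIsotropicDensity f σ)
    (hf : IsLogConcave f) (u : (Fin d → ℝ) →ₗ[ℝ] ℝ) {x₀ : Fin d → ℝ} (hx₀ : 0 < f x₀) {a : ℝ}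
    (ha : 0 < a) (hK : ∀ v, f x₀ * Real.exp (-1) ≤ f (x₀ + v) → |u v| < a) :
    ∫ x, u (x - x₀) ^ 2 * f x ≤ 4 * (1 + 2 ^ d) * a ^ 2 := by
  have hdecay : ∀ y, a ≤ |u y| → f (x₀ + y) ≤ f x₀ * Real.exp (-(|u y| / a)) := by
    intro y hy
    have ht : 1 ≤ |u y| / a := (one_le_div ha).2 hy
    refine hf.le_mul_exp_neg ht hx₀ ?_
    by_contra! hlt
    have := hK _ hlt.le
    rw [add_sub_cancel_left, map_smul, smul_eq_mul, abs_mul, abs_inv, abs_div, abs_abs,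
      abs_of_pos ha] at this
    have hy0 : |u y| ≠ 0 := by linarith
    rw [inv_div, div_mul_cancel₀ _ hy0] at this
    exact lt_irrefl _ this
  -- For `|u z| ≥ 2 a`, put `t = |u z| / (2 a)`. Decay at the midpoint `x₀ + z / 2` together with
  -- midpoint log-concavity gives `f (x₀ + z) ≤ f (x₀ + z / 2) * exp (-t)`, and `t ^ 2 * exp (-t) ≤
  -- 1`. The dilation by `1 / 2` later costs `2 ^ d` in the integral.
  have hpt : ∀ z, u z ^ 2 * f (x₀ + z) ≤
      4 * a ^ 2 * (f (x₀ + z) + f (x₀ + (2 : ℝ)⁻¹ • z)) := by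
    intro z
    have h1 := hf.1 (x₀ + z)
    have h2 := hf.1 (x₀ + (2 : ℝ)⁻¹ • z)
    rcases lt_or_ge (|u z|) (2 * a) with hz | hz
    · have : u z ^ 2 ≤ 4 * a ^ 2 := by
        rw [← sq_abs]; nlinarith [abs_nonneg (u z)]
      nlinarith [mul_le_mul_of_nonneg_right this h1, mul_nonneg (sq_nonneg a) h2]
    · have huy : |u ((2 : ℝ)⁻¹ • z)| = |u z| / 2 := by
        rw [map_smul, smul_eq_mul, abs_mul]; norm_num; ring
      have hd := hdecay ((2 : ℝ)⁻¹ • z) (by rw [huy]; linarith)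
      rw [huy] at hd
      set t := |u z| / 2 / a with ht
      have ht0 : 0 ≤ t := by positivity
      have huz : u z ^ 2 = 4 * a ^ 2 * t ^ 2 := by
        rw [← sq_abs, ht]; field_simp; norm_num
      have hm := hf.mul_le_sq x₀ (x₀ + z)
      rw [show (2 : ℝ)⁻¹ • x₀ + (2 : ℝ)⁻¹ • (x₀ + z) = x₀ + (2 : ℝ)⁻¹ • z by module] at hm
      have h3 : f (x₀ + z) ≤ f (x₀ + (2 : ℝ)⁻¹ • z) * Real.exp (-t) := by
        refine le_of_mul_le_mul_left (hm.trans ?_) hx₀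
        nlinarith [mul_le_mul_of_nonneg_left hd h2]
      have h5 : t ^ 2 * Real.exp (-t) ≤ 1 := by
        have h6 : Real.exp t = Real.exp (t / 2) ^ 2 := by
          rw [← Real.exp_nat_mul]; congr 1; push_cast; ring
        have h7 : t ≤ Real.exp (t / 2) := by
          have h8 := Real.quadratic_le_exp_of_nonneg (x := t / 2) (by positivity)
          nlinarith [sq_nonneg (t / 2 - 1)]
        rw [Real.exp_neg, ← div_eq_mul_inv, div_le_iff₀ (Real.exp_pos t), h6, one_mul]
        exact pow_le_pow_left₀ ht0 h7 2
      rw [huz]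
      have h6 : t ^ 2 * f (x₀ + z) ≤ f (x₀ + (2 : ℝ)⁻¹ • z) := by
        nlinarith [mul_le_mul_of_nonneg_left h3 (sq_nonneg t),
          mul_le_mul_of_nonneg_left h5 h2]
      nlinarith [mul_le_mul_of_nonneg_left h6 (by positivity : 0 ≤ 4 * a ^ 2),
        mul_nonneg (sq_nonneg a) h1]
  have ei : Integrable fun z => f (x₀ + z) := h.integrable.comp_add_left x₀
  have ei2 : Integrable fun z => f (x₀ + (2 : ℝ)⁻¹ • z) :=
    ei.comp_smul (by norm_num : (2 : ℝ)⁻¹ ≠ 0)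
  have e1 : ∫ z, f (x₀ + z) = 1 := by
    rw [integral_add_left_eq_self (μ := volume) f x₀, h.integral_eq]
  have e2 : ∫ z, f (x₀ + (2 : ℝ)⁻¹ • z) = 2 ^ d := by
    rw [Measure.integral_comp_smul volume (fun z => f (x₀ + z)), e1]
    simp
  calc ∫ x, u (x - x₀) ^ 2 * f x = ∫ z, u z ^ 2 * f (x₀ + z) := by
        rw [← integral_add_left_eq_self (μ := volume) (fun x => u (x - x₀) ^ 2 * f x) x₀]
        simp
    _ ≤ ∫ z, 4 * a ^ 2 * (f (x₀ + z) + f (x₀ + (2 : ℝ)⁻¹ • z)) := by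
        refine integral_mono ?_ ((ei.add ei2).const_mul _) hpt
        have := (h.integrable_sq_linear_sub u x₀).comp_add_left x₀
        simpa using this
    _ = 4 * (1 + 2 ^ d) * a ^ 2 := by
        rw [integral_const_mul, integral_add ei ei2, e1, e2]; ring

end Isotropic

/-! ### Large determinants inside wide convex sets -/

/-- If every linear functional is, up to the factor `c`, as large on `K` as on the rows of `W`,
then there is a matrix with rows in `K` whose determinant is comparable to that of `W`. -/
theorem exists_rows_mem_det_ge {d : ℕ} (K : Set (Fin d → ℝ)) {c : ℝ} (hc : 0 ≤ c)
    (W : Matrix (Fin d) (Fin d) ℝ)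
    (h : ∀ (u : (Fin d → ℝ) →ₗ[ℝ] ℝ) (i : Fin d), ∃ v ∈ K, c * |u (W i)| ≤ |u v|) :
    ∃ V : Matrix (Fin d) (Fin d) ℝ, (∀ i, V i ∈ K) ∧ c ^ d * |W.det| ≤ |V.det| := by
  -- The rows in `s` have already been exchanged. The determinant is linear in the next row, so the
  -- hypothesis applies to that functional and each exchange loses one factor `c`.
  have key : ∀ s : Finset (Fin d), ∃ V : Fin d → Fin d → ℝ, (∀ i ∈ s, V i ∈ K) ∧
      (∀ i ∉ s, V i = W i) ∧ c ^ s.card * |W.det| ≤ |(Matrix.of V).det| := by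
    intro s
    induction s using Finset.induction_on with
    | empty => exact ⟨fun i => W i, by simp, by simp, by
        rw [Finset.card_empty, pow_zero, one_mul]; exact le_refl |W.det|⟩
    | insert i s his ih =>
      obtain ⟨V, hV1, hV2, hV3⟩ := ih
      let u : (Fin d → ℝ) →ₗ[ℝ] ℝ :=
        (Matrix.detRowAlternating (R := ℝ) (n := Fin d)).toMultilinearMap.toLinearMap V i
      have hu : ∀ x, u x = (Matrix.of (Function.update V i x)).det := fun x => rfl
      obtain ⟨v, hvK, hv⟩ := h u i
      refine ⟨Function.update V i v, fun j hj => ?_, fun j hj => ?_, ?_⟩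
      · rcases eq_or_ne j i with rfl | hji
        · simpa using hvK
        · rw [Function.update_of_ne hji]
          exact hV1 j (Finset.mem_of_mem_insert_of_ne hj hji)
      · rw [Finset.mem_insert, not_or] at hj
        rw [Function.update_of_ne hj.1]
        exact hV2 j hj.2
      · rw [hu, hu, ← hV2 i his, Function.update_eq_self] at hv
        rw [Finset.card_insert_of_notMem his, pow_succ]
        refine le_trans ?_ hv
        calc c ^ s.card * c * |W.det| = c * (c ^ s.card * |W.det|) := by ring
          _ ≤ c * |(Matrix.of V).det| := mul_le_mul_of_nonneg_left hV3 hc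
  obtain ⟨V, h1, -, h3⟩ := key Finset.univ
  exact ⟨Matrix.of V, fun i => h1 i (Finset.mem_univ i), by simpa using h3⟩

/-- The sum is the average of the points `(d * y i) • V i`, each on the segment from `0` to `V i`.
-/
theorem Convex.sum_smul_mem_of_zero_mem {d : ℕ} {K : Set (Fin d → ℝ)} (hK : Convex ℝ K)
    (h0 : 0 ∈ K) (hd : 0 < d) {V : Fin d → Fin d → ℝ} (hV : ∀ i, V i ∈ K) {y : Fin d → ℝ}
    (hy0 : ∀ i, 0 ≤ y i) (hy1 : ∀ i, y i ≤ (d : ℝ)⁻¹) : ∑ i, y i • V i ∈ K := by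
  have hd' : (0 : ℝ) < d := by exact_mod_cast hd
  have e : ∑ i, y i • V i = ∑ i, (d : ℝ)⁻¹ • ((d * y i) • V i) := by
    refine Finset.sum_congr rfl fun i _ => ?_
    rw [smul_smul, ← mul_assoc, inv_mul_cancel₀ hd'.ne', one_mul]
  rw [e]
  refine hK.sum_mem (fun i _ => by positivity) ?_ fun i _ => ?_
  · simp [hd'.ne']
  · refine hK.smul_mem_of_zero_mem h0 (hV i) ⟨mul_nonneg hd'.le (hy0 i), ?_⟩
    calc (d : ℝ) * y i ≤ d * (d : ℝ)⁻¹ := mul_le_mul_of_nonneg_left (hy1 i) hd'.le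
      _ = 1 := mul_inv_cancel₀ hd'.ne'

/-! ### Pointwise bounds for isotropic log-concave densities -/

section Isotropic

variable {d : ℕ} {f : (Fin d → ℝ) → ℝ} {σ : ℝ}

/-- A density that is at least `ε` at `x₀` and at the points `x₀ + V i` carries mass at least
`ε * |det V| / d ^ d`. -/
theorem IsIsotropicDensity.mul_abs_det_le (h : IsIsotropicDensity f σ) (hf : IsLogConcave f)
    (hd : 0 < d) {ε : ℝ} (hε : 0 < ε) {x₀ : Fin d → ℝ} (h0 : ε ≤ f x₀)
    (V : Matrix (Fin d) (Fin d) ℝ) (hV : ∀ i, ε ≤ f (x₀ + V i)) :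
    ε * |V.det| ≤ (d : ℝ) ^ d := by
  have hd' : (0 : ℝ) < d := by exact_mod_cast hd
  let T : (Fin d → ℝ) →ₗ[ℝ] (Fin d → ℝ) := Matrix.toLin' V.transpose
  -- A cube inside the standard simplex: its image stays in the convex hull of `0` and the rows of
  -- `V`, and its volume is immediate.
  let Q : Set (Fin d → ℝ) := Set.Icc 0 (fun _ => (d : ℝ)⁻¹)
  have hconv : Convex ℝ {v | ε ≤ f (x₀ + v)} :=
    (hf.convex_superlevel hε).translate_preimage_right x₀
  have hTQ : T '' Q ⊆ {v | ε ≤ f (x₀ + v)} := by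
    rintro _ ⟨y, ⟨hy0, hy1⟩, rfl⟩
    have e : T y = ∑ i, y i • V i := by
      ext j
      simp [T, Matrix.mulVec, dotProduct, mul_comm]
    rw [e]
    exact hconv.sum_smul_mem_of_zero_mem (by simpa using h0) hd hV hy0 hy1
  have hvol : volume.real (T '' Q) = |V.det| * ((d : ℝ)⁻¹) ^ d := by
    rw [measureReal_def, Measure.addHaar_image_linearMap, Real.volume_Icc_pi]
    have : LinearMap.det T = V.det := by
      simp [T]
    simp [this]
  have hi : Integrable fun v => f (x₀ + v) := h.integrable.comp_add_left x₀
  have hfin : volume {v | ε ≤ f (x₀ + v)} ≠ ⊤ := (hi.measure_ge_lt_top hε).ne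
  have hM := mul_meas_ge_le_integral_of_nonneg
    (Filter.Eventually.of_forall fun v => h.nonneg (x₀ + v)) hi ε
  rw [integral_add_left_eq_self (μ := volume) f x₀, h.integral_eq] at hM
  have h2 := (mul_le_mul_of_nonneg_left (measureReal_mono hTQ hfin) hε.le).trans hM
  rw [hvol, ← mul_assoc, inv_pow, ← div_eq_mul_inv, div_le_one (by positivity)] at h2
  exact h2

/-- The set where `f (x₀ + ·)` is at least `f x₀ / e` is wide in every direction. -/
theorem IsIsotropicDensity.exists_superlevel_linear_ge (h : IsIsotropicDensity f σ)
    (hf : IsLogConcave f) (u : (Fin d → ℝ) →ₗ[ℝ] ℝ) {x₀ w : Fin d → ℝ} (hx₀ : 0 < f x₀)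
    (hw : u w ^ 2 ≤ σ ^ 2 * ∑ i, u (Pi.single i 1) ^ 2 + u x₀ ^ 2) :
    ∃ v ∈ {v | f x₀ * Real.exp (-1) ≤ f (x₀ + v)}, (4 * 2 ^ d : ℝ)⁻¹ * |u w| ≤ |u v| := by
  have hle : f x₀ * Real.exp (-1) ≤ f x₀ :=
    mul_le_of_le_one_right hx₀.le (Real.exp_le_one_iff.2 (by norm_num))
  rcases eq_or_ne (u w) 0 with h0 | h0
  · exact ⟨0, by simpa using hle, by simp [h0]⟩
  by_contra! hcon
  have ha : 0 < (4 * 2 ^ d : ℝ)⁻¹ * |u w| := by positivity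
  have h1 := h.integral_sq_linear_sub_le hf u hx₀ ha hcon
  rw [h.integral_sq_linear_sub] at h1
  have h2 := hw.trans h1
  rw [mul_pow, sq_abs] at h2
  have hpos : 0 < u w ^ 2 := by positivity
  have hp : (1 : ℝ) ≤ 2 ^ d := one_le_pow₀ (by norm_num)
  -- The width constant is chosen so that the upper bound for the second moment falls below `u w ^
  -- 2`.
  have h3 : 4 * (1 + 2 ^ d) * ((4 * 2 ^ d : ℝ)⁻¹) ^ 2 < 1 := by
    rw [inv_pow, ← div_eq_mul_inv, div_lt_one (by positivity)]
    nlinarith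
  nlinarith

/-- The right side of `hW` is the second moment of `u` about `x₀`. Both `σ • Pi.single i 1` and `x₀`
itself are admissible rows. -/
theorem IsIsotropicDensity.mul_abs_det_le_of_rows (h : IsIsotropicDensity f σ)
    (hf : IsLogConcave f) (hd : 0 < d) (x₀ : Fin d → ℝ) (W : Matrix (Fin d) (Fin d) ℝ)
    (hW : ∀ (u : (Fin d → ℝ) →ₗ[ℝ] ℝ) (i : Fin d),
      u (W i) ^ 2 ≤ σ ^ 2 * ∑ i, u (Pi.single i 1) ^ 2 + u x₀ ^ 2) :
    f x₀ * |W.det| ≤ Real.exp 1 * (4 * 2 ^ d * d) ^ d := by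
  rcases (h.nonneg x₀).eq_or_lt with h0 | h0
  · rw [← h0, zero_mul]; positivity
  obtain ⟨V, hV, hdet⟩ := exists_rows_mem_det_ge {v | f x₀ * Real.exp (-1) ≤ f (x₀ + v)}
    (c := (4 * 2 ^ d : ℝ)⁻¹) (by positivity) W
    fun u i => h.exists_superlevel_linear_ge hf u h0 (hW u i)
  have h1 := h.mul_abs_det_le hf hd (ε := f x₀ * Real.exp (-1)) (by positivity)
    (mul_le_of_le_one_right h0.le (Real.exp_le_one_iff.2 (by norm_num))) V hV
  have h2 := (mul_le_mul_of_nonneg_left hdet (by positivity : 0 ≤ f x₀ * Real.exp (-1))).trans h1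
  rw [Real.exp_neg, inv_pow] at h2
  rw [mul_pow _ (d : ℝ)]
  have he := Real.exp_pos 1
  have hp : (0 : ℝ) < (4 * 2 ^ d) ^ d := by positivity
  field_simp at h2
  linarith

theorem linear_smul_single_sq_le (u : (Fin d → ℝ) →ₗ[ℝ] ℝ) (x₀ : Fin d → ℝ) (i : Fin d) :
    u (σ • Pi.single i 1) ^ 2 ≤ σ ^ 2 * ∑ i, u (Pi.single i 1) ^ 2 + u x₀ ^ 2 := by
  rw [map_smul, smul_eq_mul, mul_pow]
  have := Finset.single_le_sum (f := fun j => u (Pi.single j 1) ^ 2)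
    (fun j _ => sq_nonneg _) (Finset.mem_univ i)
  nlinarith [mul_le_mul_of_nonneg_left this (sq_nonneg σ), sq_nonneg (u x₀)]

theorem IsIsotropicDensity.mul_pow_le (h : IsIsotropicDensity f σ)
    (hf : IsLogConcave f) (hd : 0 < d) (hσ : 0 < σ) (x₀ : Fin d → ℝ) :
    f x₀ * σ ^ d ≤ Real.exp 1 * (4 * 2 ^ d * d) ^ d := by
  have h1 := h.mul_abs_det_le_of_rows hf hd x₀ (σ • (1 : Matrix (Fin d) (Fin d) ℝ))
    fun u i => by
      have e : (σ • (1 : Matrix (Fin d) (Fin d) ℝ)) i = σ • Pi.single i 1 := by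
        ext j; simp [Matrix.one_apply, Pi.single_apply, eq_comm]
      rw [e]; exact linear_smul_single_sq_le u x₀ i
  simpa [abs_of_pos hσ] using h1

/-- With row `i` of `σ • 1` replaced by `x₀`, the determinant is `σ ^ (d - 1) * x₀ i`; an extra
factor `σ` on both sides avoids the exponent `d - 1`. -/
theorem IsIsotropicDensity.mul_pow_mul_abs_le (h : IsIsotropicDensity f σ)
    (hf : IsLogConcave f) (hσ : 0 < σ) (x₀ : Fin d → ℝ) (i : Fin d) :
    f x₀ * σ ^ d * |x₀ i| ≤ Real.exp 1 * (4 * 2 ^ d * d) ^ d * σ := by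
  have h1 := h.mul_abs_det_le_of_rows hf i.pos x₀
    (Matrix.updateRow (σ • (1 : Matrix (Fin d) (Fin d) ℝ)) i x₀)
    fun u j => by
      rcases eq_or_ne j i with rfl | hj
      · have e : Matrix.updateRow (σ • (1 : Matrix (Fin d) (Fin d) ℝ)) j x₀ j = x₀ := by
          ext; simp
        rw [e]
        have : 0 ≤ σ ^ 2 * ∑ i, u (Pi.single i 1) ^ 2 := by positivity
        linarith
      · have e : Matrix.updateRow (σ • (1 : Matrix (Fin d) (Fin d) ℝ)) i x₀ j =
            σ • Pi.single j 1 := by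
          ext k; simp [hj, Matrix.one_apply, Pi.single_apply, eq_comm]
        rw [e]; exact linear_smul_single_sq_le u x₀ j
  have hdet : (Matrix.updateRow (σ • (1 : Matrix (Fin d) (Fin d) ℝ)) i x₀).det * σ =
      σ ^ d * x₀ i := by
    have e : x₀ = ∑ k, (x₀ k * σ⁻¹) • (σ • (1 : Matrix (Fin d) (Fin d) ℝ)) k := by
      ext j
      simp [Matrix.one_apply, hσ.ne']
    conv_lhs => rw [e]
    rw [Matrix.det_updateRow_sum]
    simp
    field_simp
  have h2 := mul_le_mul_of_nonneg_right h1 hσ.le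
  rwa [mul_assoc, ← abs_of_pos hσ, ← abs_mul, abs_of_pos hσ, hdet, abs_mul,
    abs_of_pos (pow_pos hσ d), ← mul_assoc] at h2

/-- By Chebyshev's inequality, the density cannot be small on the whole cube of radius `2 d σ`. -/
theorem IsIsotropicDensity.exists_norm_le_pow_mul_ge (h : IsIsotropicDensity f σ) (hd : 0 < d)
    (hσ : 0 < σ) :
    ∃ p : Fin d → ℝ, ‖p‖ ≤ 2 * d * σ ∧ (4 * (4 * d) ^ d : ℝ)⁻¹ ≤ f p * σ ^ d := by
  by_contra! hcon
  have hd' : (1 : ℝ) ≤ d := by exact_mod_cast hd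
  set c : ℝ := (4 * (4 * d) ^ d : ℝ)⁻¹ * (σ ^ d)⁻¹ with hc
  have hc0 : 0 ≤ c := by positivity
  let Q : Set (Fin d → ℝ) := Metric.closedBall 0 (2 * d * σ)
  have hQ : volume.real Q = (4 * d * σ) ^ d := by
    rw [measureReal_def, Real.volume_pi_closedBall _ (by positivity),
      ENNReal.toReal_ofReal (by positivity)]
    simp only [Fintype.card_fin]
    ring
  -- Integrating this would give `1 ≤ 1 / 4 + 1 / (4 * d)`.
  have hpt : ∀ x, f x ≤ Q.indicator (fun _ => c) x +
      ∑ i, (4 * d ^ 2 * σ ^ 2 : ℝ)⁻¹ * (x i * x i * f x) := by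
    intro x
    have hs : 0 ≤ ∑ i, (4 * d ^ 2 * σ ^ 2 : ℝ)⁻¹ * (x i * x i * f x) :=
      Finset.sum_nonneg fun i _ => mul_nonneg (by positivity)
        (mul_nonneg (mul_self_nonneg _) (h.nonneg x))
    by_cases hx : x ∈ Q
    · rw [Set.indicator_of_mem hx]
      have := hcon x (by simpa [Q] using hx)
      have h2 : f x ≤ c := by
        rw [hc, ← div_eq_mul_inv, le_div_iff₀ (by positivity)]; exact this.le
      linarith
    · rw [Set.indicator_of_notMem hx, zero_add]
      have hx' : 2 * d * σ < ‖x‖ := by simpa [Q] using hx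
      obtain ⟨i, hi⟩ : ∃ i, 2 * d * σ < |x i| := by
        by_contra! hall
        exact absurd ((pi_norm_le_iff_of_nonneg (by positivity)).2 hall) (not_le.2 hx')
      refine le_trans ?_ (Finset.single_le_sum (fun i _ => mul_nonneg (by positivity)
        (mul_nonneg (mul_self_nonneg _) (h.nonneg x))) (Finset.mem_univ i))
      have h2 : 4 * d ^ 2 * σ ^ 2 ≤ x i * x i := by
        rw [← abs_mul_abs_self]
        calc 4 * (d : ℝ) ^ 2 * σ ^ 2 = (2 * d * σ) * (2 * d * σ) := by ring
          _ ≤ _ := mul_self_le_mul_self (by positivity) hi.le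
      rw [inv_mul_eq_div, le_div_iff₀ (by positivity), mul_comm]
      exact mul_le_mul_of_nonneg_right h2 (h.nonneg x)
  have i1 : Integrable (Q.indicator fun _ => c) :=
    (integrable_indicator_iff Metric.isClosed_closedBall.measurableSet).2
      (integrableOn_const (Metric.isBounded_closedBall.measure_lt_top.ne))
  have i2 : Integrable fun x : Fin d → ℝ =>
      ∑ i, (4 * d ^ 2 * σ ^ 2 : ℝ)⁻¹ * (x i * x i * f x) :=
    integrable_finsetSum _ fun i _ => (h.integrable_two i i).const_mul _
  have hle := integral_mono h.integrable (i1.add i2) hpt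
  simp only [Pi.add_apply] at hle
  rw [integral_add i1 i2, h.integral_eq,
    integral_finsetSum _ fun i _ => (h.integrable_two i i).const_mul _,
    integral_indicator Metric.isClosed_closedBall.measurableSet, setIntegral_const, hQ] at hle
  simp only [integral_const_mul, h.integral_two, if_true, Finset.sum_const, Finset.card_univ,
    Fintype.card_fin, nsmul_eq_mul, smul_eq_mul] at hle
  have e1 : (4 * d * σ) ^ d * c = 1 / 4 := by
    rw [hc, mul_pow]
    field_simp
  have e2 : (d : ℝ) * ((4 * d ^ 2 * σ ^ 2 : ℝ)⁻¹ * σ ^ 2) = 1 / (4 * d) := by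
    field_simp
  have e3 : 1 / (4 * d : ℝ) ≤ 1 / 4 := one_div_le_one_div_of_le (by norm_num) (by linarith)
  rw [e1, e2] at hle
  linarith

end Isotropic

/-! ### Uniform exponential decay -/

/-- Centered isotropic logarithmically concave densities decay exponentially on the scale of their
standard deviation, uniformly in the density. -/
theorem exists_isotropic_le_exp (d : ℕ) (hd : 0 < d) :
    ∃ A α : ℝ, 0 < A ∧ 0 < α ∧ ∀ (f : (Fin d → ℝ) → ℝ) (σ : ℝ), IsLogConcave f → 0 < σ →
      IsIsotropicDensity f σ → ∀ x, f x ≤ A / σ ^ d * Real.exp (-(α * (∑ i, |x i|) / σ)) := by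
  have hd' : (0 : ℝ) < d := by exact_mod_cast hd
  set C : ℝ := Real.exp 1 * (4 * 2 ^ d * d) ^ d with hC
  set c : ℝ := (4 * (4 * d) ^ d : ℝ)⁻¹ with hc
  set R : ℝ := C * Real.exp 1 / c with hR
  have hC0 : 0 < C := by positivity
  have hc0 : 0 < c := by positivity
  have hR0 : 0 < R := by positivity
  -- One factor `e` covers the ball of radius `ρ` around `p`, the other the shift of center from `p`
  -- to `0`. The `d` in the rate compares the `ℓ¹` norm with the sup norm.
  refine ⟨C * Real.exp 2, (d * (R + 2 * d))⁻¹, by positivity, by positivity, ?_⟩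
  intro f σ hf hσ h x
  have hσd : 0 < σ ^ d := pow_pos hσ d
  have hbound : ∀ y, f y ≤ C / σ ^ d := fun y => by
    rw [le_div_iff₀ hσd]; exact h.mul_pow_le hf hd hσ y
  obtain ⟨p, hp, hfp⟩ := h.exists_norm_le_pow_mul_ge hd hσ
  have hfp0 : 0 < f p := by
    by_contra! hn
    have : f p * σ ^ d ≤ 0 := mul_nonpos_of_nonpos_of_nonneg hn hσd.le
    linarith
  have hfar : ∀ z : Fin d → ℝ, R * σ ≤ ‖z‖ → f z ≤ f p * Real.exp (-1) := by
    intro z hz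
    have hn : f z * σ ^ d * ‖z‖ ≤ C * σ := by
      have : Nonempty (Fin d) := ⟨⟨0, hd⟩⟩
      obtain ⟨i, hi⟩ := Finite.exists_max fun i => |z i|
      exact (mul_le_mul_of_nonneg_left ((pi_norm_le_iff_of_nonneg (abs_nonneg (z i))).2 hi)
        (mul_nonneg (hf.1 z) hσd.le)).trans (h.mul_pow_mul_abs_le hf hσ z i)
    have h1 : f z * σ ^ d * (R * σ) ≤ C * σ :=
      (mul_le_mul_of_nonneg_left hz (mul_nonneg (hf.1 z) hσd.le)).trans hn
    have h2 : f z * σ ^ d * R ≤ C := by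
      rw [← mul_assoc] at h1
      exact le_of_mul_le_mul_right h1 hσ
    have h3 : f z * σ ^ d ≤ c * Real.exp (-1) := by
      rw [Real.exp_neg, ← div_eq_mul_inv, le_div_iff₀ (Real.exp_pos 1)]
      rw [hR, ← mul_div_assoc, div_le_iff₀ hc0] at h2
      refine le_of_mul_le_mul_left ?_ hC0
      linarith
    have h4 : f z * σ ^ d ≤ f p * Real.exp (-1) * σ ^ d := by
      refine h3.trans ?_
      rw [mul_right_comm]
      exact mul_le_mul_of_nonneg_right hfp (Real.exp_pos _).le
    exact le_of_mul_le_mul_right h4 hσd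
  set ρ : ℝ := (R + 2 * d) * σ with hρ
  have hρ0 : 0 < ρ := by positivity
  have hexp : f x ≤ C / σ ^ d * Real.exp (1 - ‖x - p‖ / ρ) := by
    rcases le_or_gt (‖x - p‖) ρ with hs | hs
    · refine (hbound x).trans (le_mul_of_one_le_right (by positivity) ?_)
      rw [Real.one_le_exp_iff]
      have := (div_le_one hρ0).2 hs
      linarith
    · have ht : 1 ≤ ‖x - p‖ / ρ := ((one_lt_div hρ0).2 hs).le
      have hs0 : 0 < ‖x - p‖ := hρ0.trans hs
      -- The intermediate point is at distance `ρ` from `p`, hence has norm at least `ρ - 2 * d * σ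
      -- = R * σ`.
      have h1 := hf.le_mul_exp_neg ht hfp0 (x := x) (hfar _ (by
        have h2 : ‖(‖x - p‖ / ρ)⁻¹ • (x - p)‖ = ρ := by
          rw [norm_smul, norm_inv, norm_div, norm_norm, Real.norm_of_nonneg hρ0.le, inv_div,
            div_mul_cancel₀ _ hs0.ne']
        have h3 := norm_sub_le_norm_add ((‖x - p‖ / ρ)⁻¹ • (x - p)) p
        rw [h2, add_comm] at h3
        have : R * σ = ρ - 2 * d * σ := by rw [hρ]; ring
        linarith))
      refine h1.trans (mul_le_mul (hbound p) ?_ (Real.exp_pos _).le (by positivity))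
      exact Real.exp_le_exp.2 (by linarith)
  refine hexp.trans ?_
  rw [mul_div_right_comm C, mul_assoc (C / σ ^ d), ← Real.exp_add]
  refine mul_le_mul_of_nonneg_left (Real.exp_le_exp.2 ?_) (by positivity)
  have h1 : ∑ i, |x i| ≤ d * ‖x‖ := by
    calc ∑ i, |x i| ≤ ∑ _i : Fin d, ‖x‖ := Finset.sum_le_sum fun i _ => norm_le_pi_norm x i
      _ = d * ‖x‖ := by simp
  have h2 : (d * (R + 2 * d))⁻¹ * (∑ i, |x i|) / σ ≤ ‖x‖ / ρ := by
    rw [hρ, inv_mul_eq_div, div_div, div_le_div_iff₀ (by positivity) (by positivity)]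
    nlinarith [mul_le_mul_of_nonneg_right h1 (by positivity : 0 ≤ (R + 2 * d) * σ)]
  have h3 : ‖x‖ ≤ ‖x - p‖ + 2 * d * σ := by
    have := norm_add_le (x - p) p
    rw [sub_add_cancel] at this
    linarith
  have h4 : 2 * d * σ / ρ ≤ 1 := by
    rw [div_le_one hρ0, hρ]
    exact mul_le_mul_of_nonneg_right (by linarith) hσ.le
  have h5 : ‖x‖ / ρ ≤ ‖x - p‖ / ρ + 2 * d * σ / ρ := by
    rw [← add_div]
    exact div_le_div_of_nonneg_right h3 hρ0.le
  linarith

/-! ### One-dimensional variation and exponential sums -/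

/-- The decreasing part of the variation of a unimodal function along interlaced points. -/
theorem sum_sub_le_of_unimodal {h : ℝ → ℝ} (h0 : ∀ x, 0 ≤ h x)
    (hq : ∀ x y z, x ≤ y → y ≤ z → min (h x) (h z) ≤ h y) {t : ℝ} (ht0 : 0 ≤ t) (ht1 : t ≤ 1)
    (s : Finset ℤ) (hs : ∀ k ∈ s, h (k + t) < h k) :
    ∀ B, 0 ≤ B → (∀ k ∈ s, h k ≤ B) → ∑ k ∈ s, (h k - h (k + t)) ≤ B := by
  induction s using Finset.induction_on_min with
  | empty => intro B hB _; simpa using hB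
  | insert a s ha ih =>
    intro B hB hsB
    rw [Finset.sum_insert fun h => lt_irrefl _ (ha a h)]
    -- After a strict drop from `a` to `a + t`, unimodality keeps all later values below `h (a +
    -- t)`, which becomes the new bound; the sum telescopes.
    have h1 := ih (fun k hk => hs k (Finset.mem_insert_of_mem hk)) (h (a + t)) (h0 _) fun k hk => by
      have hak : (a : ℝ) + 1 ≤ k := by exact_mod_cast ha k hk
      have h2 := hq a (a + t) k (by linarith) (by linarith)
      rcases min_le_iff.1 h2 with h3 | h3
      · exact absurd (hs a (Finset.mem_insert_self _ _)) (not_lt.2 h3)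
      · exact h3
    have := hsB a (Finset.mem_insert_self _ _)
    linarith

/-- The variation of a bounded unimodal function along interlaced points is at most twice its
bound. -/
theorem sum_abs_sub_le_of_unimodal {h : ℝ → ℝ} (h0 : ∀ x, 0 ≤ h x)
    (hq : ∀ x y z, x ≤ y → y ≤ z → min (h x) (h z) ≤ h y) {t : ℝ} (ht0 : 0 ≤ t) (ht1 : t ≤ 1)
    {B : ℝ} (hB : ∀ x, h x ≤ B) (s : Finset ℤ) :
    ∑ k ∈ s, |h k - h (k + t)| ≤ 2 * B := by
  have hB0 : 0 ≤ B := (h0 0).trans (hB 0)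
  rw [← Finset.sum_filter_add_sum_filter_not s fun k : ℤ => h (k + t) < h k]
  have h1 : ∑ k ∈ s with h ((k : ℤ) + t) < h k, |h k - h (k + t)| ≤ B := by
    rw [Finset.sum_congr rfl fun k hk =>
      abs_of_nonneg (sub_nonneg.2 (Finset.mem_filter.1 hk).2.le)]
    exact sum_sub_le_of_unimodal h0 hq ht0 ht1 _ (fun k hk => (Finset.mem_filter.1 hk).2) B hB0
      fun k _ => hB k
  have h2 : ∑ k ∈ s with ¬ h ((k : ℤ) + t) < h k, |h k - h (k + t)| ≤ B := by
    -- The mirror image, peeling off the largest point. A step with equality says nothing about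
    -- earlier values, but it contributes nothing either.
    have key : ∀ r : Finset ℤ, (∀ k ∈ r, h k ≤ h (k + t)) → ∀ B, 0 ≤ B →
        (∀ k ∈ r, h (k + t) ≤ B) → ∑ k ∈ r, |h k - h (k + t)| ≤ B := by
      intro r
      induction r using Finset.induction_on_max with
      | empty => intro _ B hB _; simpa using hB
      | insert a r ha ih =>
        intro hr B hB hrB
        rw [Finset.sum_insert fun h => lt_irrefl _ (ha a h)]
        have haa := hr a (Finset.mem_insert_self _ _)
        rw [abs_of_nonpos (by linarith)]
        rcases haa.eq_or_lt with he | hlt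
        · have := ih (fun k hk => hr k (Finset.mem_insert_of_mem hk)) B hB
            fun k hk => hrB k (Finset.mem_insert_of_mem hk)
          linarith
        · have h1 := ih (fun k hk => hr k (Finset.mem_insert_of_mem hk)) (h a) (h0 _)
            fun k hk => by
              have hak : (k : ℝ) + 1 ≤ a := by exact_mod_cast ha k hk
              have h2 := hq (k + t) a (a + t) (by linarith) (by linarith)
              rcases min_le_iff.1 h2 with h3 | h3
              · exact h3
              · exact absurd hlt (not_lt.2 h3)
          have := hrB a (Finset.mem_insert_self _ _)
          linarith
    exact key _ (fun k hk => not_lt.1 (Finset.mem_filter.1 hk).2) B hB0 fun k _ => hB _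
  linarith

theorem sum_exp_neg_abs_le {s : ℝ} (hs : 0 < s) (T : Finset ℤ) :
    ∑ k ∈ T, Real.exp (-(s * |(k : ℝ)|)) ≤ 2 * (1 + s) / s := by
  set r := Real.exp (-s) with hr
  have hr0 : 0 ≤ r := (Real.exp_pos _).le
  have hr1 : r ≤ 1 / (1 + s) := by
    rw [hr, Real.exp_neg, ← one_div]
    exact one_div_le_one_div_of_le (by positivity) (by linarith [Real.add_one_le_exp s])
  have hlt : r < 1 := by rw [hr]; exact Real.exp_lt_one_iff.2 (by linarith)
  have hpow : ∀ n : ℕ, Real.exp (-(s * n)) = r ^ n := fun n => by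
    rw [hr, ← Real.exp_nat_mul]; congr 1; ring
  let F : ℤ → ℝ := fun k => Real.exp (-(s * |(k : ℝ)|))
  have h1 : HasSum (fun n : ℕ => F n) (1 - r)⁻¹ := by
    have e : (fun n : ℕ => F n) = fun n => r ^ n := by
      funext n
      simp only [F]
      rw [Int.cast_natCast, Nat.abs_cast, hpow]
    rw [e]
    exact hasSum_geometric_of_lt_one hr0 hlt
  have h2 : HasSum (fun n : ℕ => F (-((n : ℤ) + 1))) (r * (1 - r)⁻¹) := by
    have e : (fun n : ℕ => F (-((n : ℤ) + 1))) = fun n => r * r ^ n := by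
      funext n
      have e : |((-((n : ℤ) + 1) : ℤ) : ℝ)| = ((n + 1 : ℕ) : ℝ) := by
        rw [Int.cast_neg, abs_neg]; push_cast; exact abs_of_nonneg (by positivity)
      simp only [F]
      rw [e, hpow, pow_succ']
    rw [e]
    exact (hasSum_geometric_of_lt_one hr0 hlt).mul_left r
  have hF : HasSum F ((1 - r)⁻¹ + r * (1 - r)⁻¹) := HasSum.of_nat_of_neg_add_one h1 h2
  refine (sum_le_hasSum T (fun k _ => (Real.exp_pos (-(s * |(k : ℝ)|))).le) hF).trans ?_
  have h3 : s / (1 + s) ≤ 1 - r := by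
    have : s / (1 + s) = 1 - 1 / (1 + s) := by field_simp; ring
    linarith
  calc (1 - r)⁻¹ + r * (1 - r)⁻¹ = (1 + r) / (1 - r) := by ring
    _ ≤ 2 / (s / (1 + s)) := div_le_div₀ (by norm_num) (by linarith) (by positivity) h3
    _ = 2 * (1 + s) / s := by field_simp

/-! ### Lattice sums against integrals over unit cells -/

/-- The point of `ℝ ^ d` with the given integer coordinates. -/
def latticePoint {d : ℕ} (k : Fin d → ℤ) : Fin d → ℝ := fun i => (k i : ℝ)

@[simp]
theorem latticePoint_apply {d : ℕ} (k : Fin d → ℤ) (i : Fin d) : latticePoint k i = k i := rfl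

/-- The half-open unit cube with the given lower corner. -/
def unitCell {d : ℕ} (k : Fin d → ℤ) : Set (Fin d → ℝ) := {x | ∀ i, ⌊x i⌋ = k i}

theorem unitCell_eq_pi {d : ℕ} (k : Fin d → ℤ) :
    unitCell k = Set.univ.pi fun i => Set.Ico (k i : ℝ) (k i + 1) := by
  ext x
  simp [unitCell, Int.floor_eq_iff]

theorem measurableSet_unitCell {d : ℕ} (k : Fin d → ℤ) : MeasurableSet (unitCell k) := by
  rw [unitCell_eq_pi]
  exact MeasurableSet.univ_pi fun i => measurableSet_Ico

theorem volume_unitCell {d : ℕ} (k : Fin d → ℤ) : volume (unitCell k) = 1 := by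
  rw [unitCell_eq_pi, Real.volume_pi_Ico]
  simp

theorem preimage_add_unitCell {d : ℕ} (k : Fin d → ℤ) :
    (fun x => latticePoint k + x) ⁻¹' unitCell k = unitCell 0 := by
  ext x
  simp [unitCell]

theorem hasSum_setIntegral_unitCell {d : ℕ} {F : (Fin d → ℝ) → ℝ} (hF : Integrable F) :
    HasSum (fun k => ∫ x in unitCell k, F x) (∫ x, F x) := by
  have hU : ⋃ k, unitCell k = (Set.univ : Set (Fin d → ℝ)) :=
    Set.eq_univ_of_forall fun x => Set.mem_iUnion.2 ⟨fun i => ⌊x i⌋, fun _ => rfl⟩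
  have h := hasSum_integral_iUnion (μ := volume) (f := F) (s := unitCell)
    measurableSet_unitCell (fun k l hkl => Set.disjoint_left.2 fun x hx hy => hkl (by
      funext i
      rw [← hx i, hy i])) hF.integrableOn
  rwa [hU, setIntegral_univ] at h

theorem setIntegral_unitCell_eq {d : ℕ} (F : (Fin d → ℝ) → ℝ) (k : Fin d → ℤ) :
    ∫ x in unitCell k, F x = ∫ x in unitCell 0, F (latticePoint k + x) := by
  rw [← preimage_add_unitCell k]
  exact ((measurePreserving_add_left volume (latticePoint k)).setIntegral_preimage_emb
    (measurableEmbedding_addLeft _) F (unitCell k)).symm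

theorem abs_sub_setIntegral_unitCell_le {d : ℕ} {F : (Fin d → ℝ) → ℝ} (hF : Integrable F)
    (k : Fin d → ℤ) :
    |F (latticePoint k) - ∫ x in unitCell k, F x| ≤
      ∫ x in unitCell 0, |F (latticePoint k) - F (latticePoint k + x)| := by
  have hi : IntegrableOn (fun x => F (latticePoint k + x)) (unitCell 0) :=
    (hF.comp_add_left _).integrableOn
  have hc : IntegrableOn (fun _ : Fin d → ℝ => F (latticePoint k)) (unitCell 0) :=
    integrableOn_const (by simp [volume_unitCell])
  have e : F (latticePoint k) - ∫ x in unitCell k, F x =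
      ∫ x in unitCell 0, (F (latticePoint k) - F (latticePoint k + x)) := by
    rw [integral_sub hc hi, setIntegral_unitCell_eq, setIntegral_const, measureReal_def,
      volume_unitCell]
    simp
  rw [e]
  exact abs_integral_le_integral_abs

/-- A function whose lattice translates have uniformly bounded summed oscillation on the unit cube
has a lattice sum close to its integral. -/
theorem summable_and_abs_tsum_sub_integral_le {d : ℕ} {F : (Fin d → ℝ) → ℝ} (hF : Integrable F)
    {C : ℝ} (h : ∀ x : Fin d → ℝ, (∀ i, 0 ≤ x i) → (∀ i, x i ≤ 1) → ∀ T : Finset ℤ,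
      ∑ k ∈ Fintype.piFinset fun _ : Fin d => T,
        |F (latticePoint k) - F (latticePoint k + x)| ≤ C) :
    Summable (fun k => F (latticePoint k)) ∧ |∑' k, F (latticePoint k) - ∫ x, F x| ≤ C := by
  have hfin : ∀ S : Finset (Fin d → ℤ),
      ∑ k ∈ S, |F (latticePoint k) - ∫ x in unitCell k, F x| ≤ C := by
    intro S
    -- Enlarging `S` to a box makes it possible to sum along coordinate lines.
    let T : Finset ℤ := S.biUnion fun k => Finset.univ.image k
    have hST : S ⊆ Fintype.piFinset fun _ : Fin d => T := fun k hk => by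
      rw [Fintype.mem_piFinset]
      intro i
      exact Finset.mem_biUnion.2 ⟨k, hk, Finset.mem_image_of_mem _ (Finset.mem_univ i)⟩
    have hi : ∀ k : Fin d → ℤ, IntegrableOn
        (fun x => |F (latticePoint k) - F (latticePoint k + x)|) (unitCell 0) := fun k => by
      refine Integrable.abs (Integrable.sub ?_ (hF.comp_add_left _).integrableOn)
      exact integrableOn_const (by simp [volume_unitCell])
    calc ∑ k ∈ S, |F (latticePoint k) - ∫ x in unitCell k, F x|
        ≤ ∑ k ∈ Fintype.piFinset fun _ : Fin d => T,
            |F (latticePoint k) - ∫ x in unitCell k, F x| :=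
          Finset.sum_le_sum_of_subset_of_nonneg hST fun _ _ _ => abs_nonneg _
      _ ≤ ∑ k ∈ Fintype.piFinset fun _ : Fin d => T,
            ∫ x in unitCell 0, |F (latticePoint k) - F (latticePoint k + x)| :=
          Finset.sum_le_sum fun k _ => abs_sub_setIntegral_unitCell_le hF k
      -- After the exchange all cells share the same displacement `x`, so the hypothesis applies for
      -- each fixed `x`.
      _ = ∫ x in unitCell 0, ∑ k ∈ Fintype.piFinset fun _ : Fin d => T,
            |F (latticePoint k) - F (latticePoint k + x)| :=
          (integral_finsetSum _ fun k _ => hi k).symm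
      _ ≤ ∫ _x in unitCell (0 : Fin d → ℤ), C := by
          refine setIntegral_mono_on (integrable_finsetSum _ fun k _ => hi k)
            (integrableOn_const (by simp [volume_unitCell])) (measurableSet_unitCell 0) ?_
          intro x hx
          rw [unitCell_eq_pi] at hx
          have hx' := fun i => hx i (Set.mem_univ i)
          simp only [Pi.zero_apply, Int.cast_zero, zero_add, Set.mem_Ico] at hx'
          exact h x (fun i => (hx' i).1) (fun i => (hx' i).2.le) T
      _ = C := by
          rw [setIntegral_const, measureReal_def, volume_unitCell]
          simp
  have habs : Summable fun k => |F (latticePoint k) - ∫ x in unitCell k, F x| :=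
    summable_of_sum_le (fun _ => abs_nonneg _) hfin
  have hsub : Summable fun k => F (latticePoint k) - ∫ x in unitCell k, F x := habs.of_abs
  have hint := hasSum_setIntegral_unitCell hF
  have hsum : Summable fun k => F (latticePoint k) := by
    simpa using hsub.add hint.summable
  refine ⟨hsum, ?_⟩
  rw [← hint.tsum_eq, ← hsum.tsum_sub hint.summable]
  have hle := norm_tsum_le_tsum_norm hsub.norm
  simp only [Real.norm_eq_abs] at hle
  exact hle.trans (habs.tsum_le_of_sum_le hfin)

/-- A product bound for sums of exponentials over a box of lattice points. -/
theorem sum_piFinset_exp_neg_le {d : ℕ} {s : ℝ} (hs : 0 < s) (T : Finset ℤ) :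
    ∑ k ∈ Fintype.piFinset fun _ : Fin d => T, Real.exp (-(s * ∑ i, |(k i : ℝ)|)) ≤
      (2 * (1 + s) / s) ^ d := by
  have e : ∀ k : Fin d → ℤ, Real.exp (-(s * ∑ i, |(k i : ℝ)|)) =
      ∏ i, Real.exp (-(s * |(k i : ℝ)|)) := fun k => by
    rw [← Real.exp_sum, Finset.mul_sum, Finset.sum_neg_distrib]
  simp_rw [e]
  rw [← Finset.prod_univ_sum (fun _ : Fin d => T) fun _ (m : ℤ) => Real.exp (-(s * |(m : ℝ)|))]
  calc _ ≤ ∏ _i : Fin d, (2 * (1 + s) / s) :=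
        Finset.prod_le_prod (fun _ _ => Finset.sum_nonneg fun _ _ => (Real.exp_pos _).le)
          fun _ _ => sum_exp_neg_abs_le hs T
    _ = _ := by rw [Finset.prod_const, Finset.card_univ, Fintype.card_fin]

/-- The inner sum runs along a line parallel to axis `j`, where the one-dimensional variation bound
applies. -/
theorem sum_piFinset_insertNth {n : ℕ} (j : Fin (n + 1)) (T : Finset ℤ)
    (G : (Fin (n + 1) → ℤ) → ℝ) :
    ∑ k ∈ Fintype.piFinset fun _ : Fin (n + 1) => T, G k =
      ∑ l ∈ Fintype.piFinset fun _ : Fin n => T, ∑ m ∈ T, G (j.insertNth m l) := by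
  rw [Finset.sum_comm, ← Finset.sum_product']
  symm
  refine Finset.sum_equiv (Fin.insertNthEquiv (fun _ => ℤ) j) (fun x => ?_) fun x _ => rfl
  simp [Fintype.mem_piFinset, Fin.forall_iff_succAbove j]

theorem IsLogConcave.min_le_insertNth {n : ℕ} {f : (Fin (n + 1) → ℝ) → ℝ} (hf : IsLogConcave f)
    (j : Fin (n + 1)) (w : Fin n → ℝ) (x y z : ℝ) (hxy : x ≤ y) (hyz : y ≤ z) :
    min (f (j.insertNth x w)) (f (j.insertNth z w)) ≤ f (j.insertNth y w) := by
  rcases hxy.eq_or_lt with rfl | hxy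
  · exact min_le_left _ _
  have hxz : 0 < z - x := by linarith
  have h := hf.min_le (j.insertNth x w) (j.insertNth z w) (a := (z - y) / (z - x))
    (b := (y - x) / (z - x)) (div_nonneg (by linarith) hxz.le) (div_nonneg (by linarith) hxz.le)
    (by field_simp; ring)
  convert h using 2
  ext i
  rcases Fin.eq_self_or_eq_succAbove j i with rfl | ⟨i, rfl⟩
  · simp; field_simp; ring
  · simp; field_simp; ring

theorem sum_abs_latticePoint_sub_le {d : ℕ} (k : Fin d → ℤ) {y : Fin d → ℝ} (h0 : ∀ i, 0 ≤ y i)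
    (h1 : ∀ i, y i ≤ 1) : ∑ i, |(k i : ℝ)| - d ≤ ∑ i, |(latticePoint k + y) i| := by
  have : ∑ i : Fin d, (|(k i : ℝ)| - 1) ≤ ∑ i, |(latticePoint k + y) i| :=
    Finset.sum_le_sum fun i _ => by
      have h2 := abs_add_le ((k i : ℝ) + y i) (-y i)
      rw [add_neg_cancel_right, abs_neg, abs_of_nonneg (h0 i)] at h2
      have h3 := h1 i
      simp only [Pi.add_apply, latticePoint_apply]
      linarith
  simpa using this

/-! ### Summed oscillation of a decaying log-concave function -/

section Oscillation

variable {n : ℕ} {f : (Fin (n + 1) → ℝ) → ℝ} {M a : ℝ}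

theorem sqrt_le_of_le_exp (hM : 0 ≤ M) (ha : 0 < a)
    (hfM : ∀ x, f x ≤ M * Real.exp (-(a * ∑ i, |x i|))) (k : Fin (n + 1) → ℤ)
    {y : Fin (n + 1) → ℝ} (h0 : ∀ i, 0 ≤ y i) (h1 : ∀ i, y i ≤ 1) :
    √(f (latticePoint k + y)) ≤
      √M * (Real.exp (a * (n + 1)) * Real.exp (-(a / 2 * ∑ i, |(k i : ℝ)|))) := by
  rw [← Real.exp_add]
  calc √(f (latticePoint k + y))
      ≤ √(M * Real.exp (-(a * ∑ i, |(latticePoint k + y) i|))) := Real.sqrt_le_sqrt (hfM _)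
    _ = √M * Real.exp (-(a * ∑ i, |(latticePoint k + y) i|) / 2) := by
        rw [Real.sqrt_mul hM, Real.exp_half]
    _ ≤ _ := by
        refine mul_le_mul_of_nonneg_left (Real.exp_le_exp.2 ?_) (Real.sqrt_nonneg _)
        have h := mul_le_mul_of_nonneg_left (sum_abs_latticePoint_sub_le k h0 h1) ha.le
        push_cast at h
        have hn : 0 ≤ a * (n + 1 : ℝ) := by positivity
        linarith

/-- The summed oscillation of `f` over the lattice for a displacement in one coordinate. -/
theorem IsLogConcave.sum_exp_mul_abs_sub_update_le (hf : IsLogConcave f) (hM : 0 ≤ M)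
    (ha : 0 < a) (hfM : ∀ x, f x ≤ M * Real.exp (-(a * ∑ i, |x i|))) (j : Fin (n + 1))
    {y : Fin (n + 1) → ℝ} (h0 : ∀ i, 0 ≤ y i) (h1 : ∀ i, y i ≤ 1) (hyj : y j = 0) {t : ℝ}
    (ht0 : 0 ≤ t) (ht1 : t ≤ 1) (T : Finset ℤ) :
    ∑ k ∈ Fintype.piFinset fun _ : Fin (n + 1) => T, Real.exp (a / 4 * ∑ i, |(k i : ℝ)|) *
        |f (latticePoint k + y) - f (latticePoint k + Function.update y j t)| ≤
      4 * M * Real.exp (a * (n + 1)) * (2 * (1 + a / 4) / (a / 4)) ^ n := by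
  have hy0 : ∀ i, 0 ≤ Function.update y j t i := fun i => by
    rcases eq_or_ne i j with rfl | hi
    · simpa using ht0
    · simpa [hi] using h0 i
  have hy1 : ∀ i, Function.update y j t i ≤ 1 := fun i => by
    rcases eq_or_ne i j with rfl | hi
    · simpa using ht1
    · simpa [hi] using h1 i
  have hq := hf.sqrt
  have hqM : ∀ x, √(f x) ≤ √M := fun x => Real.sqrt_le_sqrt ((hfM x).trans
    (mul_le_of_le_one_right hM (Real.exp_le_one_iff.2 (by
      have : 0 ≤ a * ∑ i, |x i| := mul_nonneg ha.le (Finset.sum_nonneg fun _ _ => abs_nonneg _)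
      linarith))))
  set E := Real.exp (a * (n + 1)) with hE
  -- With `f = (√f) ^ 2`, the difference is `(p + q) * (p - q)`. The sum `p + q` decays at rate `a /
  -- 2`, which pays for the weight of rate `a / 4` and leaves rate `a / 4` for summing over the
  -- other `n` coordinates. The factor `|p - q|` is kept for the variation bound in direction `j`.
  have hterm : ∀ k : Fin (n + 1) → ℤ, Real.exp (a / 4 * ∑ i, |(k i : ℝ)|) *
        |f (latticePoint k + y) - f (latticePoint k + Function.update y j t)| ≤
      2 * √M * E * (Real.exp (-(a / 4 * ∑ i, |(k (j.succAbove i) : ℝ)|)) *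
        |√(f (latticePoint k + y)) - √(f (latticePoint k + Function.update y j t))|) := by
    intro k
    have e1 := sqrt_le_of_le_exp hM ha hfM k h0 h1
    have e2 := sqrt_le_of_le_exp hM ha hfM k hy0 hy1
    set p := √(f (latticePoint k + y)) with hp
    set q := √(f (latticePoint k + Function.update y j t)) with hq
    have hfp : f (latticePoint k + y) = p ^ 2 := (Real.sq_sqrt (hf.1 _)).symm
    have hfq : f (latticePoint k + Function.update y j t) = q ^ 2 :=
      (Real.sq_sqrt (hf.1 _)).symm
    have hp0 : 0 ≤ p := Real.sqrt_nonneg _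
    have hq0 : 0 ≤ q := Real.sqrt_nonneg _
    rw [hfp, hfq, sq_sub_sq, abs_mul, abs_of_nonneg (by positivity : 0 ≤ p + q)]
    have hL : ∑ i, |(k (j.succAbove i) : ℝ)| ≤ ∑ i, |(k i : ℝ)| := by
      rw [Fin.sum_univ_succAbove _ j]
      exact le_add_of_nonneg_left (abs_nonneg _)
    have hexp : Real.exp (a / 4 * ∑ i, |(k i : ℝ)|) *
        Real.exp (-(a / 2 * ∑ i, |(k i : ℝ)|)) ≤
        Real.exp (-(a / 4 * ∑ i, |(k (j.succAbove i) : ℝ)|)) := by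
      rw [← Real.exp_add]
      refine Real.exp_le_exp.2 ?_
      have := mul_le_mul_of_nonneg_left hL ha.le
      linarith
    have h3 : Real.exp (a / 4 * ∑ i, |(k i : ℝ)|) * (p + q) ≤
        2 * √M * E * Real.exp (-(a / 4 * ∑ i, |(k (j.succAbove i) : ℝ)|)) := by
      calc Real.exp (a / 4 * ∑ i, |(k i : ℝ)|) * (p + q)
          ≤ Real.exp (a / 4 * ∑ i, |(k i : ℝ)|) *
              (2 * √M * E * Real.exp (-(a / 2 * ∑ i, |(k i : ℝ)|))) :=
            mul_le_mul_of_nonneg_left (by linarith) (Real.exp_pos _).le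
        _ = 2 * √M * E * (Real.exp (a / 4 * ∑ i, |(k i : ℝ)|) *
              Real.exp (-(a / 2 * ∑ i, |(k i : ℝ)|))) := by ring
        _ ≤ _ := mul_le_mul_of_nonneg_left hexp (by positivity)
    calc _ = Real.exp (a / 4 * ∑ i, |(k i : ℝ)|) * (p + q) * |p - q| := by ring
      _ ≤ _ := mul_le_mul_of_nonneg_right h3 (abs_nonneg _)
      _ = _ := by ring
  refine (Finset.sum_le_sum fun k _ => hterm k).trans ?_
  rw [← Finset.mul_sum, sum_piFinset_insertNth j]
  have hinner : ∀ l : Fin n → ℤ, ∑ m ∈ T,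
      Real.exp (-(a / 4 * ∑ i, |((j.insertNth m l : Fin (n + 1) → ℤ) (j.succAbove i) : ℝ)|)) *
        |√(f (latticePoint (j.insertNth m l) + y)) -
          √(f (latticePoint (j.insertNth m l) + Function.update y j t))| ≤
      Real.exp (-(a / 4 * ∑ i, |(l i : ℝ)|)) * (2 * √M) := by
    intro l
    simp only [Fin.insertNth_apply_succAbove]
    rw [← Finset.mul_sum]
    refine mul_le_mul_of_nonneg_left ?_ (Real.exp_pos _).le
    let w : Fin n → ℝ := fun i => l i + y (j.succAbove i)
    have e1 : ∀ m : ℤ, latticePoint (j.insertNth m l) + y = j.insertNth (m : ℝ) w := fun m => by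
      ext i
      rcases Fin.eq_self_or_eq_succAbove j i with rfl | ⟨i, rfl⟩
      · simp [hyj]
      · simp [w]
    have e2 : ∀ m : ℤ, latticePoint (j.insertNth m l) + Function.update y j t =
        j.insertNth ((m : ℝ) + t) w := fun m => by
      ext i
      rcases Fin.eq_self_or_eq_succAbove j i with rfl | ⟨i, rfl⟩
      · simp
      · simp [w]
    simp only [e1, e2]
    exact sum_abs_sub_le_of_unimodal (h := fun r => √(f (j.insertNth r w)))
      (fun r => Real.sqrt_nonneg _) (fun x y z => hq.min_le_insertNth j w x y z) ht0 ht1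
      (fun r => hqM _) T
  have hsum := (Finset.sum_le_sum fun l (_ : l ∈ Fintype.piFinset fun _ : Fin n => T) =>
    hinner l).trans_eq (Finset.sum_mul _ _ _).symm
  have hG := sum_piFinset_exp_neg_le (d := n) (s := a / 4) (by positivity) T
  calc _ ≤ 2 * √M * E * ((2 * (1 + a / 4) / (a / 4)) ^ n * (2 * √M)) :=
        mul_le_mul_of_nonneg_left (hsum.trans (mul_le_mul_of_nonneg_right hG (by positivity)))
          (by positivity)
    _ = 4 * (√M * √M) * E * (2 * (1 + a / 4) / (a / 4)) ^ n := by ring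
    _ = _ := by rw [Real.mul_self_sqrt hM]

/-- The summed oscillation of `f` over the lattice for a displacement within the unit cube. -/
theorem IsLogConcave.sum_exp_mul_abs_sub_le (hf : IsLogConcave f) (hM : 0 ≤ M)
    (ha : 0 < a) (hfM : ∀ x, f x ≤ M * Real.exp (-(a * ∑ i, |x i|)))
    {x : Fin (n + 1) → ℝ} (h0 : ∀ i, 0 ≤ x i) (h1 : ∀ i, x i ≤ 1) (T : Finset ℤ) :
    ∑ k ∈ Fintype.piFinset fun _ : Fin (n + 1) => T, Real.exp (a / 4 * ∑ i, |(k i : ℝ)|) *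
        |f (latticePoint k) - f (latticePoint k + x)| ≤
      (n + 1) * (4 * M * Real.exp (a * (n + 1)) * (2 * (1 + a / 4) / (a / 4)) ^ n) := by
  set B := 4 * M * Real.exp (a * (n + 1)) * (2 * (1 + a / 4) / (a / 4)) ^ n with hB
  -- A path from `0` to `x` that switches on one coordinate at a time, so the coordinate being moved
  -- starts at `0`.
  let Y : ℕ → Fin (n + 1) → ℝ := fun m i => if (i : ℕ) < m then x i else 0
  have hY0 : ∀ m i, 0 ≤ Y m i := fun m i => by
    simp only [Y]; split_ifs; exacts [h0 i, le_rfl]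
  have hY1 : ∀ m i, Y m i ≤ 1 := fun m i => by
    simp only [Y]; split_ifs; exacts [h1 i, zero_le_one]
  have key : ∀ m : ℕ, m ≤ n + 1 →
      ∑ k ∈ Fintype.piFinset fun _ : Fin (n + 1) => T, Real.exp (a / 4 * ∑ i, |(k i : ℝ)|) *
        |f (latticePoint k) - f (latticePoint k + Y m)| ≤ m * B := by
    intro m
    induction m with
    | zero =>
      intro _
      have : Y 0 = 0 := by ext i; simp [Y]
      simp [this]
    | succ m ih =>
      intro hm
      have hY : Y (m + 1) = Function.update (Y m) ⟨m, hm⟩ (x ⟨m, hm⟩) := by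
        ext i
        rcases eq_or_ne i ⟨m, hm⟩ with rfl | hi
        · simp [Y]
        · have : (i : ℕ) ≠ m := fun h => hi (Fin.ext h)
          rw [Function.update_of_ne hi]
          simp only [Y]
          congr 1
          exact propext (by omega)
      have h2 := hf.sum_exp_mul_abs_sub_update_le hM ha hfM ⟨m, hm⟩ (hY0 m) (hY1 m)
        (by simp [Y]) (h0 ⟨m, hm⟩) (h1 ⟨m, hm⟩) T
      rw [← hY] at h2
      have h3 := add_le_add (ih (by omega)) h2
      rw [← Finset.sum_add_distrib] at h3
      refine le_trans (Finset.sum_le_sum fun k _ => ?_) (h3.trans_eq (by push_cast; ring))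
      rw [← mul_add]
      exact mul_le_mul_of_nonneg_left (abs_sub_le _ _ _) (Real.exp_pos _).le
  have hx : Y (n + 1) = x := by ext i; simp only [Y, if_pos i.2]
  have := key (n + 1) le_rfl
  rw [hx] at this
  exact_mod_cast this

/-- The product rule for differences: `φ` times the oscillation of `f`, plus the oscillation of `φ`
times `f`. The exponential allowance for `φ` accommodates polynomial weights. -/
theorem IsLogConcave.sum_abs_mul_sub_mul_le (hf : IsLogConcave f) (hM : 0 ≤ M)
    (ha : 0 < a) (hfM : ∀ x, f x ≤ M * Real.exp (-(a * ∑ i, |x i|))) {φ : (Fin (n + 1) → ℝ) → ℝ}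
    {P Q : ℝ} (hQ : 0 ≤ Q)
    (hφ : ∀ k, |φ (latticePoint k)| ≤ P * Real.exp (a / 4 * ∑ i, |(k i : ℝ)|))
    {x : Fin (n + 1) → ℝ} (h0 : ∀ i, 0 ≤ x i) (h1 : ∀ i, x i ≤ 1)
    (hφx : ∀ k, |φ (latticePoint k) - φ (latticePoint k + x)| ≤
      Q * Real.exp (a / 4 * ∑ i, |(k i : ℝ)|)) (T : Finset ℤ) :
    ∑ k ∈ Fintype.piFinset fun _ : Fin (n + 1) => T, |φ (latticePoint k) * f (latticePoint k) -
        φ (latticePoint k + x) * f (latticePoint k + x)| ≤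
      P * ((n + 1) * (4 * M * Real.exp (a * (n + 1)) * (2 * (1 + a / 4) / (a / 4)) ^ n)) +
      Q * (M * Real.exp (a * (n + 1)) * (2 * (1 + a / 4) / (a / 4)) ^ (n + 1)) := by
  have hP : 0 ≤ P := by
    have := (abs_nonneg _).trans (hφ 0)
    simpa using this
  have hterm : ∀ k : Fin (n + 1) → ℤ, |φ (latticePoint k) * f (latticePoint k) -
        φ (latticePoint k + x) * f (latticePoint k + x)| ≤
      P * (Real.exp (a / 4 * ∑ i, |(k i : ℝ)|) * |f (latticePoint k) - f (latticePoint k + x)|) +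
      Q * (M * Real.exp (a * (n + 1)) * Real.exp (-(a / 4 * ∑ i, |(k i : ℝ)|))) := by
    intro k
    have hS : 0 ≤ ∑ i, |(k i : ℝ)| := Finset.sum_nonneg fun _ _ => abs_nonneg _
    have hfx : Real.exp (a / 4 * ∑ i, |(k i : ℝ)|) * f (latticePoint k + x) ≤
        M * Real.exp (a * (n + 1)) * Real.exp (-(a / 4 * ∑ i, |(k i : ℝ)|)) := by
      refine (mul_le_mul_of_nonneg_left (hfM _) (Real.exp_pos _).le).trans ?_
      rw [mul_left_comm, ← Real.exp_add, mul_assoc, ← Real.exp_add]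
      refine mul_le_mul_of_nonneg_left (Real.exp_le_exp.2 ?_) hM
      have h := mul_le_mul_of_nonneg_left (sum_abs_latticePoint_sub_le k h0 h1) ha.le
      push_cast at h
      have := mul_nonneg ha.le hS
      linarith
    have e : φ (latticePoint k) * f (latticePoint k) -
        φ (latticePoint k + x) * f (latticePoint k + x) =
        φ (latticePoint k) * (f (latticePoint k) - f (latticePoint k + x)) +
        (φ (latticePoint k) - φ (latticePoint k + x)) * f (latticePoint k + x) := by ring
    rw [e]
    refine (abs_add_le _ _).trans (add_le_add ?_ ?_)
    · rw [abs_mul, ← mul_assoc]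
      exact mul_le_mul_of_nonneg_right (hφ k) (abs_nonneg _)
    · rw [abs_mul, abs_of_nonneg (hf.1 _)]
      refine (mul_le_mul_of_nonneg_right (hφx k) (hf.1 _)).trans ?_
      rw [mul_assoc]
      exact mul_le_mul_of_nonneg_left hfx hQ
  refine (Finset.sum_le_sum fun k _ => hterm k).trans ?_
  rw [Finset.sum_add_distrib, ← Finset.mul_sum, ← Finset.mul_sum, ← Finset.mul_sum]
  exact add_le_add
    (mul_le_mul_of_nonneg_left (hf.sum_exp_mul_abs_sub_le hM ha hfM h0 h1 T) hP)
    (mul_le_mul_of_nonneg_left (mul_le_mul_of_nonneg_left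
      (sum_piFinset_exp_neg_le (by positivity) T) (by positivity)) hQ)

end Oscillation

/-! ### Lattice moments up to order two -/

/-- Lattice sums of `φ * f` approximate the integral, uniformly over centered isotropic
logarithmically concave densities `f`, with an error governed by the size `P` of `φ` and its
oscillation `Q` over unit cubes. -/
theorem exists_abs_tsum_sub_integral_le (n : ℕ) :
    ∃ C α : ℝ, 0 < C ∧ 0 < α ∧ ∀ (f : (Fin (n + 1) → ℝ) → ℝ) (σ : ℝ), IsLogConcave f → 1 ≤ σ →
      IsIsotropicDensity f σ → ∀ (φ : (Fin (n + 1) → ℝ) → ℝ) (P Q : ℝ), 0 ≤ Q →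
      (Integrable fun x => φ x * f x) →
      (∀ k, |φ (latticePoint k)| ≤ P * Real.exp (α / σ / 4 * ∑ i, |(k i : ℝ)|)) →
      (∀ x : Fin (n + 1) → ℝ, (∀ i, 0 ≤ x i) → (∀ i, x i ≤ 1) → ∀ k,
        |φ (latticePoint k) - φ (latticePoint k + x)| ≤
          Q * Real.exp (α / σ / 4 * ∑ i, |(k i : ℝ)|)) →
      Summable (fun k => φ (latticePoint k) * f (latticePoint k)) ∧
        |∑' k, φ (latticePoint k) * f (latticePoint k) - ∫ x, φ x * f x| ≤ C * (P / σ + Q) := by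
  obtain ⟨A, α, hA, hα, hbound⟩ := exists_isotropic_le_exp (n + 1) n.succ_pos
  set g : ℝ := 2 * (1 + 4 / α) with hg
  have hg0 : 0 < g := by positivity
  set E : ℝ := Real.exp (α * (n + 1)) with hE
  set C₁ : ℝ := (n + 1) * (4 * A * E * g ^ n) with hC₁
  set C₂ : ℝ := A * E * g ^ (n + 1) with hC₂
  have hC₁0 : 0 < C₁ := by positivity
  have hC₂0 : 0 < C₂ := by positivity
  refine ⟨C₁ + C₂, α, by positivity, hα, ?_⟩
  intro f σ hf hσ h φ P Q hQ hint hφ hφx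
  have hσ0 : 0 < σ := by linarith
  have ha : 0 < α / σ := by positivity
  have haα : α / σ ≤ α := div_le_self hα.le hσ
  have hP : 0 ≤ P := by
    have := (abs_nonneg _).trans (hφ 0)
    simpa using this
  have hfM : ∀ x, f x ≤ A / σ ^ (n + 1) * Real.exp (-(α / σ * ∑ i, |x i|)) := fun x => by
    rw [div_mul_eq_mul_div α]
    exact hbound f σ hf hσ0 h x
  have hG : 2 * (1 + α / σ / 4) / (α / σ / 4) ≤ g * σ := by
    have : 2 * (1 + α / σ / 4) / (α / σ / 4) = 2 * (1 + 4 / α * σ) := by field_simp; ring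
    rw [this, hg]
    linarith
  have hEle : Real.exp (α / σ * (n + 1)) ≤ E :=
    Real.exp_le_exp.2 (mul_le_mul_of_nonneg_right haα (by positivity))
  -- The variation bound has already used one direction: only `n` sums of order `σ` meet `σ ^ (-(n +
  -- 1))`, which gains `1 / σ`. In `h2` all `n + 1` sums occur and nothing is gained.
  have h1 : (n + 1) * (4 * (A / σ ^ (n + 1)) * Real.exp (α / σ * (n + 1)) *
      (2 * (1 + α / σ / 4) / (α / σ / 4)) ^ n) ≤ C₁ / σ := by
    calc _ ≤ (n + 1) * (4 * (A / σ ^ (n + 1)) * E * (g * σ) ^ n) := by gcongr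
      _ = C₁ / σ := by rw [hC₁, mul_pow, pow_succ σ]; field_simp
  have h2 : A / σ ^ (n + 1) * Real.exp (α / σ * (n + 1)) *
      (2 * (1 + α / σ / 4) / (α / σ / 4)) ^ (n + 1) ≤ C₂ := by
    calc _ ≤ A / σ ^ (n + 1) * E * (g * σ) ^ (n + 1) := by gcongr
      _ = C₂ := by rw [hC₂, mul_pow]; field_simp
  refine summable_and_abs_tsum_sub_integral_le hint fun x hx0 hx1 T => ?_
  refine (hf.sum_abs_mul_sub_mul_le (by positivity) ha hfM hQ hφ hx0 hx1
    (hφx x hx0 hx1) T).trans ?_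
  calc _ ≤ P * (C₁ / σ) + Q * C₂ :=
        add_le_add (mul_le_mul_of_nonneg_left h1 hP) (mul_le_mul_of_nonneg_left h2 hQ)
    _ = C₁ * (P / σ) + C₂ * Q := by ring
    _ ≤ (C₁ + C₂) * (P / σ + Q) := by
        have : 0 ≤ P / σ := by positivity
        nlinarith [mul_nonneg hC₁0.le hQ, mul_nonneg hC₂0.le this]

/-- Trades a linear weight for the exponential allowance at the cost of a factor of order `σ`; the
quadratic analogue costs `σ ^ 2`. -/
theorem le_mul_exp_div {α σ : ℝ} (hα : 0 < α) (hσ : 0 < σ) (s : ℝ) :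
    s ≤ 4 / α * σ * Real.exp (α / σ / 4 * s) := by
  have h := Real.add_one_le_exp (α / σ / 4 * s)
  calc s = 4 / α * σ * (α / σ / 4 * s) := by field_simp
    _ ≤ _ := mul_le_mul_of_nonneg_left (by linarith) (by positivity)

theorem sq_le_mul_exp_div {α σ s : ℝ} (hα : 0 < α) (hσ : 0 < σ) (hs : 0 ≤ s) :
    s ^ 2 ≤ 2 * (4 / α * σ) ^ 2 * Real.exp (α / σ / 4 * s) := by
  have h := Real.quadratic_le_exp_of_nonneg (x := α / σ / 4 * s) (by positivity)
  have h0 : 0 ≤ α / σ / 4 * s := by positivity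
  calc s ^ 2 = 2 * (4 / α * σ) ^ 2 * ((α / σ / 4 * s) ^ 2 / 2) := by field_simp
    _ ≤ _ := mul_le_mul_of_nonneg_left (by linarith) (by positivity)

/-- The lattice moments of order at most two of a centered isotropic logarithmically concave
density approximate the moments of the density. -/
theorem exists_lattice_moments_le (n : ℕ) :
    ∃ D : ℝ, 0 < D ∧ ∀ (f : (Fin (n + 1) → ℝ) → ℝ) (σ : ℝ), IsLogConcave f → 1 ≤ σ →
      IsIsotropicDensity f σ →
      (Summable (latticeRestrict f) ∧ |∑' k, latticeRestrict f k - 1| ≤ D / σ) ∧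
      (∀ i, (Summable fun k : Fin (n + 1) → ℤ => (k i : ℝ) * latticeRestrict f k) ∧
        |∑' k : Fin (n + 1) → ℤ, (k i : ℝ) * latticeRestrict f k| ≤ D) ∧
      (∀ i j, (Summable fun k : Fin (n + 1) → ℤ => (k i : ℝ) * (k j : ℝ) * latticeRestrict f k) ∧
        |∑' k : Fin (n + 1) → ℤ, (k i : ℝ) * (k j : ℝ) * latticeRestrict f k -
          if i = j then σ ^ 2 else 0| ≤ D * σ) := by
  obtain ⟨C, α, hC, hα, hmain⟩ := exists_abs_tsum_sub_integral_le n
  set b : ℝ := 4 / α with hb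
  have hb0 : 0 < b := by positivity
  -- Dominates the three values of `P / σ + Q`, namely `1 / σ`, `b + 1` and `2 * b ^ 2 * σ + 2 * b *
  -- σ + 1`, relative to `1 / σ`, `1` and `σ`.
  refine ⟨C * (2 * b ^ 2 + 2 * b + 1), by positivity, ?_⟩
  intro f σ hf hσ h
  have hσ0 : 0 < σ := by linarith
  have hS : ∀ k : Fin (n + 1) → ℤ, 0 ≤ ∑ i, |(k i : ℝ)| := fun k =>
    Finset.sum_nonneg fun _ _ => abs_nonneg _
  have hexp : ∀ k : Fin (n + 1) → ℤ, 1 ≤ Real.exp (α / σ / 4 * ∑ i, |(k i : ℝ)|) := fun k =>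
    Real.one_le_exp_iff.2 (mul_nonneg (by positivity) (hS k))
  have hk : ∀ (k : Fin (n + 1) → ℤ) i, |(k i : ℝ)| ≤ ∑ i, |(k i : ℝ)| := fun k i =>
    Finset.single_le_sum (f := fun i => |(k i : ℝ)|) (fun _ _ => abs_nonneg _) (Finset.mem_univ i)
  refine ⟨?_, fun i => ?_, fun i j => ?_⟩
  · have := hmain f σ hf hσ h (fun _ => 1) 1 0 le_rfl (by simpa using h.integrable)
      (fun k => by simpa using hexp k) (fun x _ _ k => by simp)
    simp only [one_mul, h.integral_eq, add_zero] at this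
    refine ⟨this.1, this.2.trans ?_⟩
    rw [mul_one_div]
    refine div_le_div_of_nonneg_right (le_mul_of_one_le_right hC.le ?_) hσ0.le
    nlinarith
  · have := hmain f σ hf hσ h (fun x => x i) (b * σ) 1 zero_le_one (h.integrable_one i)
      (fun k => (hk k i).trans (le_mul_exp_div hα hσ0 _))
      (fun x hx0 hx1 k => by
        have e : latticePoint k i - (latticePoint k + x) i = -x i := by simp
        rw [e, abs_neg, abs_of_nonneg (hx0 i), one_mul]
        exact (hx1 i).trans (hexp k))
    rw [h.integral_one, sub_zero] at this
    refine ⟨this.1, this.2.trans (mul_le_mul_of_nonneg_left ?_ hC.le)⟩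
    rw [mul_div_assoc, div_self hσ0.ne']
    nlinarith
  · have := hmain f σ hf hσ h (fun x => x i * x j) (2 * (b * σ) ^ 2) (2 * (b * σ) + 1)
      (by positivity) (h.integrable_two i j)
      (fun k => by
        refine le_trans ?_ (sq_le_mul_exp_div hα hσ0 (hS k))
        rw [abs_mul, sq]
        exact mul_le_mul (hk k i) (hk k j) (abs_nonneg _) (hS k))
      (fun x hx0 hx1 k => by
        have e : latticePoint k i * latticePoint k j -
            (latticePoint k + x) i * (latticePoint k + x) j =
            -(k i * x j + x i * k j + x i * x j) := by
          simp only [Pi.add_apply, latticePoint_apply]; ring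
        rw [e, abs_neg]
        have e1 : |(k i : ℝ) * x j| ≤ ∑ i, |(k i : ℝ)| := by
          rw [abs_mul, abs_of_nonneg (hx0 j)]
          exact (mul_le_of_le_one_right (abs_nonneg _) (hx1 j)).trans (hk k i)
        have e2 : |x i * (k j : ℝ)| ≤ ∑ i, |(k i : ℝ)| := by
          rw [abs_mul, abs_of_nonneg (hx0 i)]
          exact (mul_le_of_le_one_left (abs_nonneg _) (hx1 i)).trans (hk k j)
        have e3 : |x i * x j| ≤ 1 := by
          rw [abs_of_nonneg (mul_nonneg (hx0 i) (hx0 j))]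
          exact mul_le_one₀ (hx1 i) (hx0 j) (hx1 j)
        have e4 := le_mul_exp_div hα hσ0 (∑ i, |(k i : ℝ)|)
        have e5 := hexp k
        have e6 := abs_add_three ((k i : ℝ) * x j) (x i * k j) (x i * x j)
        rw [add_mul, one_mul, mul_assoc]
        linarith)
    rw [h.integral_two] at this
    refine ⟨this.1, this.2.trans ?_⟩
    rw [mul_assoc]
    refine mul_le_mul_of_nonneg_left ?_ hC.le
    have e : 2 * (b * σ) ^ 2 / σ = 2 * b ^ 2 * σ := by field_simp
    rw [e]
    linarith

/-! ### Perturbation of determinants and conclusion -/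

/-- Factors are exchanged one at a time. The extra factor `R` on the left avoids the exponent
`s.card - 1`, which is awkward for empty `s`. -/
theorem abs_prod_sub_prod_mul_le {ι : Type*} (s : Finset ι) {a b : ι → ℝ} {R ε : ℝ} (hR : 0 ≤ R)
    (ha : ∀ i, |a i| ≤ R) (hb : ∀ i, |b i| ≤ R) (hab : ∀ i, |a i - b i| ≤ ε) :
    |∏ i ∈ s, a i - ∏ i ∈ s, b i| * R ≤ s.card * R ^ s.card * ε := by
  classical
  induction s using Finset.induction_on with
  | empty => simp
  | insert i s hi ih =>
    rw [Finset.prod_insert hi, Finset.prod_insert hi, Finset.card_insert_of_notMem hi]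
    have hbs : |∏ i ∈ s, b i| ≤ R ^ s.card := by
      rw [Finset.abs_prod, ← Finset.prod_const]
      exact Finset.prod_le_prod (fun _ _ => abs_nonneg _) fun i _ => hb i
    have e : a i * ∏ i ∈ s, a i - b i * ∏ i ∈ s, b i =
        a i * (∏ i ∈ s, a i - ∏ i ∈ s, b i) + (a i - b i) * ∏ i ∈ s, b i := by ring
    have h1 : |a i * (∏ i ∈ s, a i - ∏ i ∈ s, b i)| * R ≤ R * (s.card * R ^ s.card * ε) := by
      rw [abs_mul, mul_assoc]
      exact mul_le_mul (ha i) ih (by positivity) hR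
    have h2 : |(a i - b i) * ∏ i ∈ s, b i| * R ≤ ε * R ^ s.card * R := by
      rw [abs_mul]
      exact mul_le_mul_of_nonneg_right (mul_le_mul (hab i) hbs (abs_nonneg _)
        ((abs_nonneg _).trans (hab i))) hR
    rw [e]
    calc _ ≤ (|a i * (∏ i ∈ s, a i - ∏ i ∈ s, b i)| + |(a i - b i) * ∏ i ∈ s, b i|) * R :=
          mul_le_mul_of_nonneg_right (abs_add_le _ _) hR
      _ ≤ R * (s.card * R ^ s.card * ε) + ε * R ^ s.card * R := by rw [add_mul]; linarith
      _ = _ := by push_cast; ring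

theorem abs_det_sub_det_mul_le {d : ℕ} {A B : Matrix (Fin d) (Fin d) ℝ} {R ε : ℝ} (hR : 0 ≤ R)
    (hA : ∀ i j, |A i j| ≤ R) (hB : ∀ i j, |B i j| ≤ R) (hAB : ∀ i j, |A i j - B i j| ≤ ε) :
    |A.det - B.det| * R ≤ d.factorial * (d * R ^ d * ε) := by
  rw [Matrix.det_apply', Matrix.det_apply', ← Finset.sum_sub_distrib]
  calc _ ≤ (∑ τ : Equiv.Perm (Fin d), |(Equiv.Perm.sign τ : ℝ) * ∏ i, A (τ i) i -
          (Equiv.Perm.sign τ : ℝ) * ∏ i, B (τ i) i|) * R :=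
        mul_le_mul_of_nonneg_right (Finset.abs_sum_le_sum_abs _ _) hR
    _ = ∑ τ : Equiv.Perm (Fin d), |∏ i, A (τ i) i - ∏ i, B (τ i) i| * R := by
        rw [Finset.sum_mul]
        refine Finset.sum_congr rfl fun τ _ => ?_
        have : |((Equiv.Perm.sign τ : ℤ) : ℝ)| = 1 := by
          rw [← Int.cast_abs, Int.isUnit_iff_abs_eq.1 (Equiv.Perm.sign τ).isUnit, Int.cast_one]
        rw [← mul_sub, abs_mul, this, one_mul]
    _ ≤ ∑ _τ : Equiv.Perm (Fin d), d * R ^ d * ε := by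
        refine Finset.sum_le_sum fun τ _ => ?_
        simpa using abs_prod_sub_prod_mul_le Finset.univ (a := fun i => A (τ i) i)
          (b := fun i => B (τ i) i) hR (fun i => hA _ _) (fun i => hB _ _) fun i => hAB _ _
    _ = _ := by
        rw [Finset.sum_const, Finset.card_univ, Fintype.card_perm, Fintype.card_fin, nsmul_eq_mul]

/-- Here `δ` is the continuous second moment. Since `δ ≤ σ ^ 2`, the normalization error `δ * (S₀ -
1)` is at most `D * σ`, the same order as the error of `S₂`; the product of first moments is only
`O(1)`. -/
theorem abs_div_sub_div_sub_le {S₀ S₁ S₁' S₂ δ D σ : ℝ} (hσ : 1 ≤ σ) (h0 : |S₀ - 1| ≤ D / σ)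
    (hhalf : 1 / 2 ≤ S₀) (h1 : |S₁| ≤ D) (h1' : |S₁'| ≤ D) (h2 : |S₂ - δ| ≤ D * σ)
    (hδ0 : 0 ≤ δ) (hδ : δ ≤ σ ^ 2) :
    |S₂ / S₀ - S₁ * S₁' / S₀ ^ 2 - δ| ≤ (4 * D + 4 * D ^ 2) * σ := by
  have hσ0 : 0 < σ := by linarith
  have hS : 0 < S₀ := by linarith
  have hD : 0 ≤ D := (abs_nonneg _).trans h1
  have e : S₂ / S₀ - S₁ * S₁' / S₀ ^ 2 - δ =
      (S₂ - δ - δ * (S₀ - 1)) / S₀ - S₁ * S₁' / S₀ ^ 2 := by field_simp; ring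
  have a1 : |(S₂ - δ - δ * (S₀ - 1)) / S₀| ≤ 4 * D * σ := by
    rw [abs_div, abs_of_pos hS, div_le_iff₀ hS]
    have b1 : |δ * (S₀ - 1)| ≤ D * σ := by
      rw [abs_mul, abs_of_nonneg hδ0]
      calc δ * |S₀ - 1| ≤ σ ^ 2 * (D / σ) := mul_le_mul hδ h0 (abs_nonneg _) (sq_nonneg _)
        _ = D * σ := by field_simp
    have b2 := abs_sub (S₂ - δ) (δ * (S₀ - 1))
    nlinarith [mul_le_mul_of_nonneg_left hhalf (by positivity : 0 ≤ 4 * D * σ)]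
  have a2 : |S₁ * S₁' / S₀ ^ 2| ≤ 4 * D ^ 2 := by
    rw [abs_div, abs_of_pos (pow_pos hS 2), div_le_iff₀ (pow_pos hS 2), abs_mul]
    have b1 : |S₁| * |S₁'| ≤ D * D := mul_le_mul h1 h1' (abs_nonneg _) hD
    have b2 : (1 / 2 : ℝ) ^ 2 ≤ S₀ ^ 2 := pow_le_pow_left₀ (by norm_num) hhalf 2
    nlinarith [mul_le_mul_of_nonneg_left b2 (by positivity : 0 ≤ 4 * D ^ 2)]
  rw [e]
  have := abs_sub ((S₂ - δ - δ * (S₀ - 1)) / S₀) (S₁ * S₁' / S₀ ^ 2)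
  nlinarith [mul_le_mul_of_nonneg_left hσ (by positivity : 0 ≤ 4 * D ^ 2)]

theorem mainTheorem4 (d : ℕ) (hd : 1 ≤ d) :
    ∃ C N : ℝ, 0 < C ∧ 0 < N ∧
      ∀ (f : (Fin d → ℝ) → ℝ) (σ : ℝ),
        IsLogConcave f → IsDensity f → IsCentered f →
        0 < σ → covR f = σ ^ 2 • (1 : Matrix (Fin d) (Fin d) ℝ) →
        N ≤ σ →
          HasCovZ (latticeRestrict f) ∧
          (∀ i, |covZ (latticeRestrict f) i i - σ ^ 2| ≤ C * σ) ∧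
          (∀ i j, i ≠ j → |covZ (latticeRestrict f) i j| ≤ C * σ) ∧
          |(covZ (latticeRestrict f)).det - σ ^ (2 * d)| ≤ C * σ ^ (2 * d - 1) := by
  obtain ⟨n, rfl⟩ : ∃ n, d = n + 1 := ⟨d - 1, by omega⟩
  obtain ⟨D, hD, hmom⟩ := exists_lattice_moments_le n
  set D' : ℝ := 4 * D + 4 * D ^ 2 with hD'
  set K : ℝ := (n + 1).factorial * ((n + 1 : ℕ) * 2 ^ (n + 1)) with hK
  have hD'0 : 0 < D' := by positivity
  have hK1 : 1 ≤ K := by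
    have h1 : (1 : ℝ) ≤ (n + 1).factorial := by exact_mod_cast (n + 1).factorial_pos
    have h2 : (1 : ℝ) ≤ (n + 1 : ℕ) := by exact_mod_cast n.succ_pos
    have h3 : (1 : ℝ) ≤ 2 ^ (n + 1) := one_le_pow₀ (by norm_num)
    exact one_le_mul_of_one_le_of_one_le h1 (one_le_mul_of_one_le_of_one_le h2 h3)
  -- The summands of the threshold ensure `σ ≥ 1`, a normalizing sum of at least `1 / 2`, and `D' *
  -- σ ≤ σ ^ 2`, which bounds all entries by `2 * σ ^ 2`.
  refine ⟨K * D', 1 + 2 * D + D', by positivity, by positivity, ?_⟩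
  intro f σ hf hdens hcent hσ hcov hN
  have hσ1 : 1 ≤ σ := by linarith
  have hCD : D' * σ ≤ K * D' * σ :=
    mul_le_mul_of_nonneg_right (le_mul_of_one_le_left hD'0.le hK1) hσ.le
  obtain ⟨⟨s0, b0⟩, m1, m2⟩ := hmom f σ hf hσ1 (isIsotropicDensity_of_covR hdens hcent hσ hcov)
  have hhalf : 1 / 2 ≤ ∑' k, latticeRestrict f k := by
    have h1 : D / σ ≤ 1 / 2 := by rw [div_le_iff₀ hσ]; linarith
    have := (abs_le.1 b0).1
    linarith
  have hentry : ∀ i j, |covZ (latticeRestrict f) i j - (σ ^ 2 • (1 : Matrix _ _ ℝ)) i j| ≤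
      D' * σ := by
    intro i j
    have e : (σ ^ 2 • (1 : Matrix (Fin (n + 1)) (Fin (n + 1)) ℝ)) i j =
        if i = j then σ ^ 2 else 0 := by simp [Matrix.one_apply]
    rw [e]
    refine abs_div_sub_div_sub_le hσ1 b0 hhalf (m1 i).2 (m1 j).2 (m2 i j).2 ?_ ?_
    · split_ifs; exacts [sq_nonneg σ, le_rfl]
    · split_ifs; exacts [le_rfl, sq_nonneg σ]
  refine ⟨⟨s0, fun i => (m1 i).1, fun i j => (m2 i j).1, by linarith⟩, fun i => ?_,
    fun i j hij => ?_, ?_⟩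
  · have := hentry i i
    simp only [Matrix.smul_apply, Matrix.one_apply_eq, smul_eq_mul, mul_one] at this
    exact this.trans hCD
  · have := hentry i j
    simp only [Matrix.smul_apply, Matrix.one_apply_ne hij, smul_zero, sub_zero] at this
    exact this.trans hCD
  · have hB : ∀ i j, |(σ ^ 2 • (1 : Matrix (Fin (n + 1)) (Fin (n + 1)) ℝ)) i j| ≤ σ ^ 2 := by
      intro i j
      rw [Matrix.smul_apply, Matrix.one_apply, smul_eq_mul]
      split_ifs
      · simp
      · simpa using sq_nonneg σ
    have hDσ : D' * σ ≤ σ ^ 2 := by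
      rw [sq]; exact mul_le_mul_of_nonneg_right (by linarith) hσ.le
    have hA : ∀ i j, |covZ (latticeRestrict f) i j| ≤ 2 * σ ^ 2 := by
      intro i j
      have h1 := abs_sub_abs_le_abs_sub (covZ (latticeRestrict f) i j)
        ((σ ^ 2 • (1 : Matrix (Fin (n + 1)) (Fin (n + 1)) ℝ)) i j)
      have h2 := hentry i j
      have h3 := hB i j
      linarith
    have h := abs_det_sub_det_mul_le (by positivity) hA
      (fun i j => (hB i j).trans (by nlinarith [sq_nonneg σ])) hentry
    have hdet : (σ ^ 2 • (1 : Matrix (Fin (n + 1)) (Fin (n + 1)) ℝ)).det =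
        σ ^ (2 * (n + 1)) := by
      rw [Matrix.det_smul, Matrix.det_one, mul_one, Fintype.card_fin, ← pow_mul]
    rw [hdet] at h
    set X := |(covZ (latticeRestrict f)).det - σ ^ (2 * (n + 1))| with hX
    have hX0 : 0 ≤ X := abs_nonneg _
    -- The perturbation bound with `R = 2 * σ ^ 2` and `ε = D' * σ`; cancelling `σ ^ 2` leaves the
    -- exponent `2 * (n + 1) - 1`.
    have e : ((n + 1).factorial : ℝ) * ((n + 1 : ℕ) * (2 * σ ^ 2) ^ (n + 1) * (D' * σ)) =
        K * D' * σ ^ (2 * (n + 1) - 1) * σ ^ 2 := by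
      rw [show 2 * (n + 1) - 1 = 2 * n + 1 by omega, hK]
      ring
    rw [e] at h
    refine le_of_mul_le_mul_right (le_trans ?_ h) (pow_pos hσ 2)
    nlinarith [mul_nonneg hX0 (sq_nonneg σ)]
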